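/- Let $G$ be a (finite-dimensional, smooth, real) Lie group with multiplication $\mu$ and unit $e$, let $\mathfrak g$ be the Lie algebra of left-invariant vector fields on $G$, and let $TG$ be the tangent Lie group, with multiplication $T\mu(v,w)=T_hL_g\,w+T_gR_h\,v$ for $v\in T_gG$, $w\in T_hG$, unit $0_e$ and inversion $T\iota$, where $\iota$ is the inversion of $G$. For a vector field $X$ on $G$, let $X^v$ and $X^c$ be its vertical and complete lifts to $TG$: $X^v$ at $y\in T_xG$ is the velocity at $t=0$ of $t\mapsto y+tX(x)$, and $X^c$ at $y$ is the velocity at $t=0$ of $t\mapsto T\varphi_t(y)$, where $\varphi_t$ is the local flow of $X$ (in coordinates induced by a chart of $G$: $X^v=(0,X(x))$ and $X^c=(X(x),DX(x)y)$). Let $g^1,g^2$ be two bi-invariant Riemannian metrics on $G$. Then there is exactly one left-invariant Riemannian metric $\tilde g$ on $TG$ such that, for all $X,Y\in\mathfrak g$, $$\tilde g(X^c,Y^c)=g^1(X,Y),\qquad \tilde g(X^v,Y^v)=g^2(X,Y),\qquad \tilde g(X^c,Y^v)=0 .$$ If $\tilde\nabla$ denotes the Levi-Civita connection of $(TG,\tilde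 g)$, then for all $X,Y\in\mathfrak g$ $$\tilde\nabla_{X^v}Y^v=0,\qquad \tilde\nabla_{X^c}Y^c=\tfrac12[X,Y]^c,\qquad \tilde\nabla_{X^v}Y^c=0,\qquad \tilde\nabla_{X^c}Y^v=[X,Y]^v .$$ In particular, $\tilde g$ need not be bi-invariant: there are a connected Lie group $G$ and bi-invariant Riemannian metrics $g^1,g^2$ on $G$ for which $\tilde g$ is not a bi-invariant metric on $TG$. -/

import Mathlib

open Bundle
open scoped Manifold ContDiff

noncomputable section

/-! ### Lifts of vector fields to the tangent bundle -/

section Lifts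

variable {E : Type*} [NormedAddCommGroup E] [NormedSpace ℝ E]
  {H : Type*} [TopologicalSpace H] {I : ModelWithCorners ℝ E H}
  {M : Type*} [TopologicalSpace M] [ChartedSpace H M] [IsManifold I 1 M]

/-- The vertical lift `X^v` of a vector field `X` on `M`: its value at `p = (x, y)`, `y ∈ T_x M`,
is the velocity at `t = 0` of the curve `t ↦ y + t X(x)` in `TM`. -/
def verticalLift (X : (x : M) → TangentSpace I x) (p : TangentBundle I M) :
    TangentSpace I.tangent p :=
  mfderiv 𝓘(ℝ, ℝ) I.tangent
    (fun t : ℝ => (⟨p.1, p.2 + t • X p.1⟩ : TangentBundle I M)) 0 (1 : ℝ)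

/-- The complete lift `X^c` of a vector field `X` on `M`, i.e. `κ ∘ TX` with `κ` the canonical flip
of `TTM`; this is the velocity at `t = 0` of `t ↦ Tφ_t (p)`, where `φ` is the local flow of `X`.

Here the derivative `TX (y) ∈ T_{X(x)} TM` at `p = (x, y)` is a pair in `E × E`, in the coordinates
of `TM` induced by the preferred chart of `M` at `x`; the same coordinates are used by Mathlib for
`T_p TM`. In these, `TX (y) = (y, DX(x) y)`, and the flip `κ` sends it to `(X(x), DX(x) y)`,
the usual local expression of the complete lift. -/
def completeLift (X : (x : M) → TangentSpace I x) (p : TangentBundle I M) :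
    TangentSpace I.tangent p :=
  letI w : E × E := mfderiv I I.tangent (fun x => (⟨x, X x⟩ : TangentBundle I M)) p.1 p.2
  ((X p.1, w.2) : E × E)

end Lifts

/-! ### The tangent group of a Lie group -/

section TangentGroup

variable {E : Type*} [NormedAddCommGroup E] [NormedSpace ℝ E]
  {H : Type*} [TopologicalSpace H] {I : ModelWithCorners ℝ E H}
  {G : Type*} [TopologicalSpace G] [ChartedSpace H G] [Group G]

/-- The multiplication `Tμ (v, w) = T_h L_g w + T_g R_h v` of `TG`, for `v ∈ T_g G`, `w ∈ T_h G`. -/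
def tangentMul (p q : TangentBundle I G) : TangentBundle I G :=
  ⟨p.1 * q.1,
    (mfderiv I I (fun x : G => p.1 * x) q.1 q.2 : E) +
      (mfderiv I I (fun x : G => x * q.1) p.1 p.2 : E)⟩

/-- The unit `0_e` of `TG`. -/
def tangentOne : TangentBundle I G := ⟨1, (0 : E)⟩

/-- The inversion `Tι` of `TG`. -/
def tangentInv (p : TangentBundle I G) : TangentBundle I G :=
  tangentMap I I (fun x : G => x⁻¹) p

theorem TangentBundle.ext_coord {M : Type*} [TopologicalSpace M] [ChartedSpace H M]
    {p q : TangentBundle I M} (h : p.1 = q.1) (h' : (p.2 : E) = (q.2 : E)) : p = q := by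
  obtain ⟨x, u⟩ := p
  obtain ⟨y, v⟩ := q
  obtain rfl : x = y := h
  exact congrArg _ h'

theorem mfderiv_apply_of_eq_id {M : Type*} [TopologicalSpace M] [ChartedSpace H M]
    {f : M → M} (hf : f = id) (a : M) (u : TangentSpace I a) :
    (mfderiv I I f a u : E) = (u : E) := by
  subst hf
  rw [mfderiv_id]
  rfl

theorem tangentOne_mul (p : TangentBundle I G) : tangentMul tangentOne p = p := by
  obtain ⟨a, u⟩ := p
  refine TangentBundle.ext_coord (one_mul a) ?_
  have e1 : (mfderiv I I (fun x : G => 1 * x) a u : E) = u :=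
    mfderiv_apply_of_eq_id (funext one_mul) a u
  have e2 : (mfderiv I I (fun x : G => x * a) 1 (0 : E) : E) = 0 :=
    (mfderiv I I (fun x : G => x * a) 1).map_zero
  exact (congrArg₂ (fun s t : E => s + t) e1 e2).trans (add_zero (M := E) u)

theorem tangentMul_one (p : TangentBundle I G) : tangentMul p tangentOne = p := by
  obtain ⟨a, u⟩ := p
  refine TangentBundle.ext_coord (mul_one a) ?_
  have e1 : (mfderiv I I (fun x : G => x * 1) a u : E) = u :=
    mfderiv_apply_of_eq_id (funext mul_one) a u
  have e2 : (mfderiv I I (fun x : G => a * x) 1 (0 : E) : E) = 0 :=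
    (mfderiv I I (fun x : G => a * x) 1).map_zero
  exact (congrArg₂ (fun s t : E => s + t) e2 e1).trans (zero_add (M := E) u)

variable [LieGroup I ∞ G]

theorem mdifferentiableAt_mulLeft (a x : G) : MDifferentiableAt I I (fun y : G => a * y) x :=
  (contMDiff_mul_left (I := I) (n := ∞)).contMDiffAt.mdifferentiableAt (by simp)

theorem mdifferentiableAt_mulRight (a x : G) : MDifferentiableAt I I (fun y : G => y * a) x :=
  (contMDiff_mul_right (I := I) (n := ∞)).contMDiffAt.mdifferentiableAt (by simp)

theorem mdifferentiableAt_groupInv (x : G) : MDifferentiableAt I I (fun y : G => y⁻¹) x :=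
  (contMDiff_inv I ∞).contMDiffAt.mdifferentiableAt (by simp)

theorem tangentMul_assoc (p q r : TangentBundle I G) :
    tangentMul (tangentMul p q) r = tangentMul p (tangentMul q r) := by
  obtain ⟨a, u⟩ := p
  obtain ⟨b, v⟩ := q
  obtain ⟨c, w⟩ := r
  have hL : mfderiv I I (fun x : G => a * b * x) c
      = (mfderiv I I (fun x : G => a * x) (b * c)).comp (mfderiv I I (fun x : G => b * x) c) := by
    rw [← mfderiv_comp c (mdifferentiableAt_mulLeft a (b * c)) (mdifferentiableAt_mulLeft b c)]
    congr 1; ext x; simp [mul_assoc]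
  have hR : mfderiv I I (fun x : G => x * (b * c)) a
      = (mfderiv I I (fun x : G => x * c) (a * b)).comp (mfderiv I I (fun x : G => x * b) a) := by
    rw [← mfderiv_comp a (mdifferentiableAt_mulRight c (a * b)) (mdifferentiableAt_mulRight b a)]
    congr 1; ext x; simp [mul_assoc]
  have hM : (mfderiv I I (fun x : G => x * c) (a * b)).comp (mfderiv I I (fun x : G => a * x) b)
      = (mfderiv I I (fun x : G => a * x) (b * c)).comp (mfderiv I I (fun x : G => x * c) b) := by
    rw [← mfderiv_comp b (mdifferentiableAt_mulRight c (a * b)) (mdifferentiableAt_mulLeft a b),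
      ← mfderiv_comp b (mdifferentiableAt_mulLeft a (b * c)) (mdifferentiableAt_mulRight c b)]
    congr 1; ext x; simp [mul_assoc]
  refine TangentBundle.ext_coord (mul_assoc a b c) ?_
  have e1 := DFunLike.congr_fun hL w
  have e2 := DFunLike.congr_fun hR u
  have e3 := DFunLike.congr_fun hM v
  have a1 := (mfderiv I I (fun x : G => x * c) (a * b)).map_add
    (mfderiv I I (fun x : G => a * x) b v) (mfderiv I I (fun x : G => x * b) a u)
  have a2 := (mfderiv I I (fun x : G => a * x) (b * c)).map_add
    (mfderiv I I (fun x : G => b * x) c w) (mfderiv I I (fun x : G => x * c) b v)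
  refine (congrArg₂ (fun s t : E => s + t) e1 a1).trans ?_
  refine Eq.trans ?_ (congrArg₂ (fun s t : E => s + t) a2 e2).symm
  refine Eq.trans ?_ (add_assoc (G := E) _ _ _).symm
  exact congrArg (fun t : E => _ + (t + _)) e3

theorem tangentInv_mul (p : TangentBundle I G) : tangentMul (tangentInv p) p = tangentOne := by
  obtain ⟨a, u⟩ := p
  refine TangentBundle.ext_coord (inv_mul_cancel a) ?_
  have hμ : MDifferentiableAt (I.prod I) I (fun z : G × G => z.1 * z.2) (a⁻¹, a) :=
    (contMDiff_mul I ∞).contMDiffAt.mdifferentiableAt (by simp)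
  have hd : MDifferentiableAt I (I.prod I) (fun x : G => (x⁻¹, x)) a :=
    (mdifferentiableAt_groupInv a).prodMk mdifferentiableAt_id
  have hp : mfderiv I (I.prod I) (fun x : G => (x⁻¹, x)) a =
      (mfderiv I I (fun x : G => x⁻¹) a).prod (mfderiv I I (id : G → G) a) :=
    mfderiv_prodMk (mdifferentiableAt_groupInv a) mdifferentiableAt_id
  have h0 : mfderiv I I ((fun z : G × G => z.1 * z.2) ∘ fun x : G => (x⁻¹, x)) a = 0 := by
    have : ((fun z : G × G => z.1 * z.2) ∘ fun x : G => (x⁻¹, x)) = fun _ => (1 : G) := by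
      ext x; simp
    rw [this]
    exact mfderiv_const
  rw [mfderiv_comp (f := fun x : G => (x⁻¹, x)) a hμ hd, hp] at h0
  have e := DFunLike.congr_fun h0 u
  have e' := mfderiv_prod_eq_add_apply hμ
    (v := ((mfderiv I I (fun x : G => x⁻¹) a u, mfderiv I I (id : G → G) a u) : E × E))
  have e4 : (mfderiv I I (id : G → G) a u : E) = u := mfderiv_apply_of_eq_id rfl a u
  have e5 := e'.symm.trans e
  refine (add_comm (G := E) _ _).trans ?_
  refine Eq.trans ?_ e5
  exact congrArg (fun t : E => _ + (mfderiv I I (fun x : G => a⁻¹ * x) a t : E)) e4.symm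

/-- The tangent group `(TG, Tμ)`, with unit `0_e` and inversion `Tι`. -/
instance tangentGroup : Group (TangentBundle I G) where
  mul := tangentMul
  mul_assoc := tangentMul_assoc
  one := tangentOne
  one_mul := tangentOne_mul
  mul_one := tangentMul_one
  inv := tangentInv
  inv_mul_cancel := tangentInv_mul

end TangentGroup

/-! ### Invariant metrics and the Levi-Civita connection -/

section Metrics

variable {E : Type*} [NormedAddCommGroup E] [NormedSpace ℝ E]
  {H : Type*} [TopologicalSpace H] {I : ModelWithCorners ℝ E H}
  {M : Type*} [TopologicalSpace M] [ChartedSpace H M]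

variable (I M) in
/-- Smooth Riemannian metrics on the manifold `M`. -/
abbrev SmoothMetric [IsManifold I 1 M] : Type _ :=
  ContMDiffRiemannianMetric I ∞ E (TangentSpace I : M → Type _)

/-- The metric `g` is left-invariant: all left translations `L_a` are isometries. -/
def SmoothMetric.IsLeftInvariant [IsManifold I 1 M] [Group M] (g : SmoothMetric I M) : Prop :=
  ∀ (a x : M) (u v : TangentSpace I x),
    g.inner (a * x) (mfderiv I I (fun y : M => a * y) x u) (mfderiv I I (fun y : M => a * y) x v) =
      g.inner x u v

/-- The metric `g` is right-invariant: all right translations `R_a` are isometries. -/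
def SmoothMetric.IsRightInvariant [IsManifold I 1 M] [Group M] (g : SmoothMetric I M) : Prop :=
  ∀ (a x : M) (u v : TangentSpace I x),
    g.inner (x * a) (mfderiv I I (fun y : M => y * a) x u) (mfderiv I I (fun y : M => y * a) x v) =
      g.inner x u v

/-- The metric `g` is bi-invariant. -/
def SmoothMetric.IsBiInvariant [IsManifold I 1 M] [Group M] (g : SmoothMetric I M) : Prop :=
  g.IsLeftInvariant ∧ g.IsRightInvariant

/-- The covariant derivative `cov` on `TM` is the Levi-Civita connection of the metric `g`: it is
torsion-free, and `v g(Y, Z) = g(∇_v Y, Z) + g(Y, ∇_v Z)` for all tangent vectors `v` and all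
vector fields `Y`, `Z` that are differentiable at the base point of `v`.
Note that `cov Y x v` is `(∇_v Y)(x)`. -/
def IsLeviCivita [FiniteDimensional ℝ E] [IsManifold I 1 M] [IsManifold I 2 M]
    (g : SmoothMetric I M)
    (cov : CovariantDerivative I E (TangentSpace I : M → Type _)) : Prop :=
  haveI : CompleteSpace E := FiniteDimensional.complete ℝ E
  cov.torsion = 0 ∧
    ∀ (x : M) (v : TangentSpace I x) (Y Z : (y : M) → TangentSpace I y),
      MDifferentiableAt I I.tangent (fun y => (⟨y, Y y⟩ : TangentBundle I M)) x →
      MDifferentiableAt I I.tangent (fun y => (⟨y, Z y⟩ : TangentBundle I M)) x →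
      (mfderiv I 𝓘(ℝ, ℝ) (fun y => g.inner y (Y y) (Z y)) x v : ℝ) =
        g.inner x (cov Y x v) (Z x) + g.inner x (Y x) (cov Z x v)

end Metrics

/-! ### The lift of two left-invariant metrics -/

section LiftedMetric

variable {E : Type*} [NormedAddCommGroup E] [NormedSpace ℝ E]
  {H : Type*} [TopologicalSpace H] {I : ModelWithCorners ℝ E H}
  {G : Type*} [TopologicalSpace G] [ChartedSpace H G] [Group G] [LieGroup I ∞ G]

/-- The complete lift `X^c` of the left-invariant vector field with value `X` at `e`. -/
def liftC (X : GroupLieAlgebra I G) (p : TangentBundle I G) : TangentSpace I.tangent p :=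
  completeLift (mulInvariantVectorField X) p

/-- The vertical lift `X^v` of the left-invariant vector field with value `X` at `e`. -/
def liftV (X : GroupLieAlgebra I G) (p : TangentBundle I G) : TangentSpace I.tangent p :=
  verticalLift (mulInvariantVectorField X) p

/-- `gt` is the lift to `TG` of the left-invariant metrics `g₁`, `g₂` on `G`: the left-invariant
metric on `TG` such that, for all left-invariant vector fields `X`, `Y` on `G`,
`gt(X^c, Y^c) = g₁(X, Y)`, `gt(X^v, Y^v) = g₂(X, Y)` and `gt(X^c, Y^v) = 0`. -/
structure IsLiftedMetric (g₁ g₂ : SmoothMetric I G)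
    (gt : SmoothMetric I.tangent (TangentBundle I G)) : Prop where
  leftInvariant : gt.IsLeftInvariant
  complete_complete : ∀ (X Y : GroupLieAlgebra I G) (p : TangentBundle I G),
    gt.inner p (liftC X p) (liftC Y p) =
      g₁.inner p.1 (mulInvariantVectorField X p.1) (mulInvariantVectorField Y p.1)
  vertical_vertical : ∀ (X Y : GroupLieAlgebra I G) (p : TangentBundle I G),
    gt.inner p (liftV X p) (liftV Y p) =
      g₂.inner p.1 (mulInvariantVectorField X p.1) (mulInvariantVectorField Y p.1)
  complete_vertical : ∀ (X Y : GroupLieAlgebra I G) (p : TangentBundle I G),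
    gt.inner p (liftC X p) (liftV Y p) = 0

end LiftedMetric

end

/-!
Everything is reduced to computations with left-invariant vector fields on `TG`. With
`T_{0_e} TG = T_e G × T_e G`, let `(X, 0)` and `(0, X)` be the complete and the vertical vector of
`X ∈ T_e G`. Left translation by `p ∈ TG` maps the curve `t ↦ tX` of `T_e G` to `t ↦ p + t X^L`,
where `X^L` is the left-invariant field of `X`, and the zero section `c ↦ 0_c` to `c ↦ T R_c (p)`,
the flow of `X^L` being right translation by a one-parameter group. So `X^v` and `X^c` are the
left-invariant fields on `TG` with values `(0, X)` and `(X, 0)` (`liftV_eq`, `liftC_eq`), and they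
span every tangent space of `TG`. A left-invariant metric is determined by its value at the unit,
and every scalar product there extends (`SmoothMetric.leftInvariant`), whence existence and
uniqueness of the lifted metric.

A tangent vector of `TG` is determined by its action on the functions `φ ∘ π` and `dφ`, where `φ` is
a chart of `G` (`tangentBundle_tangent_ext`). As `X^v (φ ∘ π) = 0`, `X^v (dφ) = (X φ) ∘ π`,
`X^c (φ ∘ π) = (X φ) ∘ π` and `X^c (dφ) = d(X φ)`, one finds
`[X^v, Y^v] = 0`, `[X^c, Y^v] = [X, Y]^v` and `[X^c, Y^c] = [X, Y]^c`. All scalar products of the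
left-invariant fields on `TG` are constant, so that the Koszul formula (`IsLeviCivita.koszul`) only
contains brackets; since `ad X` is skew-symmetric for a bi-invariant metric
(`SmoothMetric.IsBiInvariant.inner_bracket_add`), it gives the four formulas for the connection.

A left-invariant field `Y` on `G`, seen as a map `s_Y : G → TG`, satisfies
`T s_Y (X) = X^c + [X, Y]^v` along `s_Y` (`mfderiv_mulInvariantVectorField`). The quadratic form on
`TG` of a right-invariant metric on `G` is annihilated by `X^c`, and that of a left-invariant one is
constant along `s_Y`; so the identity yields the skew-symmetry of `ad X` for a bi-invariant metric.
It also shows that right translation by `Y ∈ T_e G ⊆ TG` maps `(X, 0)` to `X^c + [X, Y]^v`, whose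
squared length exceeds that of `(X, 0)` by `g²([X, Y], [X, Y])`.
Hence the lifted metric is right-invariant only if the Lie algebra of `G` is abelian
(`IsLiftedMetric.lie_eq_zero_of_isRightInvariant`). The round metric on the group `S³` of unit
quaternions is bi-invariant and the Lie algebra of `S³` is not abelian, so its lift is not
bi-invariant.
-/

noncomputable section

open VectorField Filter Topology

/-! ### Vector-valued derivatives on manifolds -/

section

variable {E : Type*} [NormedAddCommGroup E] [NormedSpace ℝ E]
  {H : Type*} [TopologicalSpace H] {I : ModelWithCorners ℝ E H}
  {M : Type*} [TopologicalSpace M] [ChartedSpace H M]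
  {E' : Type*} [NormedAddCommGroup E'] [NormedSpace ℝ E']
  {H' : Type*} [TopologicalSpace H'] {I' : ModelWithCorners ℝ E' H'}
  {M' : Type*} [TopologicalSpace M'] [ChartedSpace H' M']
  {F : Type*} [NormedAddCommGroup F] [NormedSpace ℝ F]

theorem mvfderiv_comp_mfderiv_apply {g : M' → F} {f : M → M'} (x : M)
    (hg : MDifferentiableAt I' 𝓘(ℝ, F) g (f x)) (hf : MDifferentiableAt I I' f x)
    (v : TangentSpace I x) :
    mvfderiv I (fun y => g (f y)) x v = mvfderiv I' g (f x) (mfderiv I I' f x v) :=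
  mfderiv_comp_apply x hg hf v

theorem Filter.EventuallyEq.mvfderiv_eq {f g : M → F} {x : M} (h : f =ᶠ[𝓝 x] g) :
    mvfderiv I f x = mvfderiv I g x := by
  have h1 := h.mfderiv_eq (I := I) (I' := 𝓘(ℝ, F))
  ext v
  exact congrArg (fun L : TangentSpace I x →L[ℝ] F => L v) h1

theorem mvfderiv_comp_fderiv_apply {F' : Type*} [NormedAddCommGroup F'] [NormedSpace ℝ F']
    {g : F → F'} {f : M → F} (x : M)
    (hg : DifferentiableAt ℝ g (f x)) (hf : MDifferentiableAt I 𝓘(ℝ, F) f x)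
    (v : TangentSpace I x) :
    mvfderiv I (fun y => g (f y)) x v = fderiv ℝ g (f x) (mvfderiv I f x v) := by
  have := mvfderiv_comp_mfderiv_apply (I := I) (I' := 𝓘(ℝ, F)) x hg.mdifferentiableAt hf v
  rw [this]
  have h2 : mvfderiv 𝓘(ℝ, F) g (f x) = fderiv ℝ g (f x) := by
    have := mfderiv_eq_fderiv (𝕜 := ℝ) (f := g) (x := f x)
    ext v
    exact congrArg (fun L : F →L[ℝ] F' => L v) this
  rw [h2]; rfl

theorem ContinuousLinearMap.mvfderiv_comp_apply {F' : Type*} [NormedAddCommGroup F']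
    [NormedSpace ℝ F'] (L : F →L[ℝ] F') {f : M → F} {x : M} (hf : MDifferentiableAt I 𝓘(ℝ, F) f x)
    (v : TangentSpace I x) : mvfderiv I (fun y => L (f y)) x v = L (mvfderiv I f x v) := by
  rw [mvfderiv_comp_fderiv_apply x L.differentiableAt hf, L.fderiv]

/-- The product rule for `y ↦ A (φ y) (w y)`, where the operator `A (φ y)` depends on `y` through
coordinates `φ`. -/
theorem mvfderiv_clm_comp_apply {φ : M → E'} {A : E' → E' →L[ℝ] F} {w : M → E'} {x : M}
    (hφ : MDifferentiableAt I 𝓘(ℝ, E') φ x) (hA : DifferentiableAt ℝ A (φ x))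
    (hw : MDifferentiableAt I 𝓘(ℝ, E') w x) (u : TangentSpace I x) :
    mvfderiv I (fun y => A (φ y) (w y)) x u =
      fderiv ℝ A (φ x) (mvfderiv I φ x u) (w x) + A (φ x) (mvfderiv I w x u) := by
  have hd : HasFDerivAt (fun q : E' × E' => A q.1 q.2)
      ((A (φ x)).comp (ContinuousLinearMap.snd ℝ E' E') +
        ((fderiv ℝ A (φ x)).comp (ContinuousLinearMap.fst ℝ E' E')).flip (w x)) (φ x, w x) :=
    (HasFDerivAt.comp (f := Prod.fst) (φ x, w x) hA.hasFDerivAt hasFDerivAt_fst).clm_apply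
      hasFDerivAt_snd
  have hm : MDifferentiableAt I 𝓘(ℝ, E' × E') (fun y => (φ y, w y)) x := hφ.prodMk_space hw
  have a := mvfderiv_comp_fderiv_apply (g := Prod.fst) x differentiableAt_fst hm u
  have b := mvfderiv_comp_fderiv_apply (g := Prod.snd) x differentiableAt_snd hm u
  rw [fderiv_fst] at a
  rw [fderiv_snd] at b
  refine (mvfderiv_comp_fderiv_apply (g := fun q : E' × E' => A q.1 q.2) x
    hd.differentiableAt hm u).trans ?_
  rw [hd.fderiv, add_comm]
  simp only [add_apply, ContinuousLinearMap.comp_apply,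
    ContinuousLinearMap.flip_apply]
  rw [a, b]

variable [IsManifold I 1 M]

theorem mvfderiv_extChartAt_self (x : M) (v : TangentSpace I x) :
    mvfderiv I (extChartAt I x) x v = v := by
  have := mfderiv_extChartAt_self (I := I) (x := x)
  exact congrArg (fun L : TangentSpace I x →L[ℝ] E => L v) this

/-- The fibre coordinate of the tangent bundle in the preferred chart `φ` at `x` is `dφ`. -/
theorem trivializationAt_tangent_snd {x : M} {p : TangentBundle I M}
    (hp : p.1 ∈ (chartAt H x).source) :
    (trivializationAt E (TangentSpace I) x p).2 = mvfderiv I (extChartAt I x) p.1 p.2 := by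
  have h := TangentBundle.continuousLinearMapAt_trivializationAt (I := I) hp
  have h2 := congrArg (fun L : TangentSpace I p.1 →L[ℝ] E => L p.2) h
  refine Eq.trans ?_ h2
  simp only [Trivialization.continuousLinearMapAt_apply]
  rw [Trivialization.coe_linearMapAt_of_mem _ (by simpa using hp)]

theorem MDifferentiableAt.mvfderiv_extChartAt {V : (y : M) → TangentSpace I y} {x : M}
    (hV : MDifferentiableAt I I.tangent (fun y => (⟨y, V y⟩ : TangentBundle I M)) x) :
    MDifferentiableAt I 𝓘(ℝ, E) (fun y => mvfderiv I (extChartAt I x) y (V y)) x := by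
  have h := (mdifferentiableAt_section (F := E) (E := (TangentSpace I : M → Type _)) I V).1 hV
  refine h.congr_of_eventuallyEq ?_
  filter_upwards [(chartAt H x).open_source.mem_nhds (mem_chart_source H x)] with y hy
  exact (trivializationAt_tangent_snd (p := ⟨y, V y⟩) hy).symm

/-- The derivative of `f` at `x` is that of its coordinate expression, in the preferred chart at
`x`. -/
theorem mvfderiv_apply_eq_fderiv_extChartAt [I.Boundaryless] {f : M → F} {x : M}
    (hf : MDifferentiableAt I 𝓘(ℝ, F) f x) (u : TangentSpace I x) :
    mvfderiv I f x u =
      fderiv ℝ (f ∘ (extChartAt I x).symm) (extChartAt I x x)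
        (mvfderiv I (extChartAt I x) x u) := by
  rw [hf.mvfderiv, ModelWithCorners.range_eq_univ, fderivWithin_univ]
  exact congrArg _ (mvfderiv_extChartAt_self x u).symm

theorem ContMDiffAt.contMDiffAt_tangentMap [IsManifold I' 1 M'] {f : M → M'}
    {m n : WithTop ℕ∞} {p : TangentBundle I M}
    (hf : ContMDiffAt I I' n f p.1) (hmn : m + 1 ≤ n) :
    ContMDiffAt I.tangent I'.tangent m (tangentMap I I' f) p := by
  have hproj : ContMDiffAt I.tangent I m (fun q : TangentBundle I M => q.1) p :=
    contMDiffAt_proj (TangentSpace I)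
  have hv : ContMDiffAt I.tangent I.tangent m
      (fun q : TangentBundle I M => (⟨q.1, q.2⟩ : TangentBundle I M)) p := contMDiffAt_id
  have hb₂ : ContMDiffAt I.tangent I' m (fun q : TangentBundle I M => f q.1) p :=
    (hf.of_le (le_self_add.trans hmn)).comp p hproj
  have hϕ := (ContMDiffAt.mfderiv_const hf hmn).comp p hproj
  exact ContMDiffAt.clm_apply_of_inCoordinates hϕ hv hb₂

/-- The differential of `f : M → F`, as a function `TM → F`, is smooth, with a loss of one
derivative. -/
theorem ContMDiffAt.mvfderiv_tangentBundle {f : M → F} {m n : WithTop ℕ∞} {p : TangentBundle I M}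
    (hf : ContMDiffAt I 𝓘(ℝ, F) n f p.1) (hmn : m + 1 ≤ n) :
    ContMDiffAt I.tangent 𝓘(ℝ, F) m (fun q : TangentBundle I M => mvfderiv I f q.1 q.2) p :=
  (contMDiff_snd_tangentBundle_modelSpace F 𝓘(ℝ, F)).contMDiffAt.comp p
    (hf.contMDiffAt_tangentMap hmn)

variable [I.Boundaryless]

/-- The Lie bracket in the coordinates of the preferred chart `φ`: the case `f = φ` of
`mvfderiv_mlieBracket`. -/
theorem mvfderiv_extChartAt_mlieBracket [IsManifold I 2 M]
    {V W : (y : M) → TangentSpace I y} {x : M}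
    (hV : MDifferentiableAt I I.tangent (fun y => (⟨y, V y⟩ : TangentBundle I M)) x)
    (hW : MDifferentiableAt I I.tangent (fun y => (⟨y, W y⟩ : TangentBundle I M)) x) :
    mvfderiv I (extChartAt I x) x (mlieBracket I V W x) =
      mvfderiv I (fun y => mvfderiv I (extChartAt I x) y (W y)) x (V x) -
      mvfderiv I (fun y => mvfderiv I (extChartAt I x) y (V y)) x (W x) := by
  obtain ⟨P, hP⟩ : ∃ P : ((y : M) → TangentSpace I y) → E → E,
      P = fun V => mpullbackWithin 𝓘(ℝ, E) I (extChartAt I x).symm V (Set.range I) := ⟨_, rfl⟩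
  have key (V : (y : M) → TangentSpace I y) : P V =ᶠ[𝓝 (extChartAt I x x)]
      (fun y => mvfderiv I (extChartAt I x) y (V y)) ∘ (extChartAt I x).symm := by
    filter_upwards [(isOpen_extChartAt_target x).mem_nhds (mem_extChartAt_target (I := I) x)]
      with z hz
    have h1 := mfderiv_extChartAt_comp_mfderivWithin_extChartAt_symm (I := I) hz
    have h2 := mfderivWithin_extChartAt_symm_comp_mfderiv_extChartAt (I := I) hz
    have := ContinuousLinearMap.inverse_eq h2 h1
    simp only [hP, mpullbackWithin_apply, Function.comp_apply]
    exact congrArg (fun L : TangentSpace I ((extChartAt I x).symm z) →L[ℝ] E =>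
      L (V ((extChartAt I x).symm z))) this
  have e (V : (y : M) → TangentSpace I y) :
      P V (extChartAt I x x) = mvfderiv I (extChartAt I x) x (V x) := by
    rw [(key V).eq_of_nhds, Function.comp_apply, extChartAt_to_inv]
  have hB : mvfderiv I (extChartAt I x) x (mlieBracket I V W x) =
      lieBracket ℝ (P V) (P W) (extChartAt I x x) := by
    have h := (isInvertible_mfderiv_extChartAt (I := I)
      (mem_extChartAt_source (I := I) x)).self_apply_inverse
      (lieBracketWithin ℝ (P V) (P W)
        ((extChartAt I x).symm ⁻¹' Set.univ ∩ Set.range I) (extChartAt I x x) : E)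
    rw [← lieBracketWithin_univ]
    have hs : (extChartAt I x).symm ⁻¹' Set.univ ∩ Set.range I = Set.univ := by
      rw [ModelWithCorners.range_eq_univ, Set.preimage_univ, Set.univ_inter]
    rw [hs] at h
    refine Eq.trans ?_ h
    subst hP
    rw [← hs]
    rfl
  rw [hB, mvfderiv_apply_eq_fderiv_extChartAt hV.mvfderiv_extChartAt,
    mvfderiv_apply_eq_fderiv_extChartAt hW.mvfderiv_extChartAt, ← (key V).fderiv_eq,
    ← (key W).fderiv_eq, lieBracket_eq]
  simp only [e]

/-- The Lie bracket is the commutator of derivations: `[V, W] f = V (W f) - W (V f)`. -/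
theorem mvfderiv_mlieBracket [IsManifold I 2 M] {V W : (y : M) → TangentSpace I y} {x : M}
    {f : M → F} (hf : ContMDiffAt I 𝓘(ℝ, F) 2 f x)
    (hV : MDifferentiableAt I I.tangent (fun y => (⟨y, V y⟩ : TangentBundle I M)) x)
    (hW : MDifferentiableAt I I.tangent (fun y => (⟨y, W y⟩ : TangentBundle I M)) x) :
    mvfderiv I f x (mlieBracket I V W x) =
      mvfderiv I (fun y => mvfderiv I f y (W y)) x (V x) -
      mvfderiv I (fun y => mvfderiv I f y (V y)) x (W x) := by
  set φ := extChartAt I x with hφ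
  -- In the chart, `V f = f' (V φ)`; the second derivatives of `f'` cancel by symmetry.
  set f' : E → F := f ∘ φ.symm with hf'
  have hf2 : ContDiffAt ℝ 2 f' (φ x) := by
    have := (contMDiffAt_iff.1 hf).2
    rw [ModelWithCorners.range_eq_univ, contDiffWithinAt_univ] at this
    exact this
  have hφd : MDifferentiableAt I 𝓘(ℝ, E) φ x := mdifferentiableAt_extChartAt (mem_chart_source H x)
  have hnear : ∀ᶠ y in 𝓝 x, ∀ v : TangentSpace I y,
      mvfderiv I f y v = fderiv ℝ f' (φ y) (mvfderiv I φ y v) := by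
    have h1 : ∀ᶠ y in 𝓝 x, ContDiffAt ℝ 2 f' (φ y) :=
      (continuousAt_extChartAt (I := I) x).eventually (hf2.eventually (by simp))
    filter_upwards [h1, (chartAt H x).open_source.mem_nhds (mem_chart_source H x)] with y hy hy' v
    rw [← mvfderiv_comp_fderiv_apply y (hy.differentiableAt (by simp))
      (mdifferentiableAt_extChartAt hy')]
    have : f =ᶠ[𝓝 y] fun z => f' (φ z) := by
      filter_upwards [(chartAt H x).open_source.mem_nhds hy'] with z hz
      simp only [hf', Function.comp_apply, hφ]
      rw [PartialEquiv.left_inv _ (by simpa using hz)]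
    rw [this.mvfderiv_eq]
  have hA : DifferentiableAt ℝ (fderiv ℝ f') (φ x) :=
    (hf2.fderiv_right (m := 1) (by norm_num)).differentiableAt (by simp)
  have key (V : (y : M) → TangentSpace I y)
      (hV : MDifferentiableAt I I.tangent (fun y => (⟨y, V y⟩ : TangentBundle I M)) x)
      (u : TangentSpace I x) :
      mvfderiv I (fun y => mvfderiv I f y (V y)) x u =
       (fderiv ℝ (fderiv ℝ f') (φ x) (mvfderiv I φ x u)) (mvfderiv I φ x (V x)) +
         fderiv ℝ f' (φ x) (mvfderiv I (fun y => mvfderiv I φ y (V y)) x u) := by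
    have h1 : (fun y => mvfderiv I f y (V y)) =ᶠ[𝓝 x]
        fun y => fderiv ℝ f' (φ y) (mvfderiv I φ y (V y)) := by
      filter_upwards [hnear] with y hy
      exact hy _
    rw [h1.mvfderiv_eq]
    exact mvfderiv_clm_comp_apply hφd hA hV.mvfderiv_extChartAt u
  have hsymm : IsSymmSndFDerivAt ℝ f' (φ x) := hf2.isSymmSndFDerivAt (by simp)
  rw [key V hV, key W hW, hnear.self_of_nhds, hsymm.eq, mvfderiv_extChartAt_mlieBracket hV hW,
    map_sub, ← hφ]
  abel

/-- Mixed partial derivatives of a function on a product of manifolds commute. -/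
theorem mvfderiv_mvfderiv_comm [IsManifold I' 1 M'] [I'.Boundaryless] {f : M × M' → F}
    {x : M} {c : M'} (hf : ContMDiffAt (I.prod I') 𝓘(ℝ, F) 2 f (x, c)) (u : TangentSpace I x)
    (v : TangentSpace I' c) :
    mvfderiv I' (fun c' => mvfderiv I (fun x' => f (x', c')) x u) c v =
      mvfderiv I (fun x' => mvfderiv I' (fun c' => f (x', c')) c v) x u := by
  set φ := extChartAt I x with hφ
  set ψ := extChartAt I' c with hψ
  set f' : E × E' → F := fun q => f (φ.symm q.1, ψ.symm q.2) with hf'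
  have hf2 : ContDiffAt ℝ 2 f' (φ x, ψ c) := by
    have := (contMDiffAt_iff.1 hf).2
    rw [ModelWithCorners.range_eq_univ, contDiffWithinAt_univ, extChartAt_prod] at this
    exact this
  have hφd : MDifferentiableAt I 𝓘(ℝ, E) φ x := mdifferentiableAt_extChartAt (mem_chart_source H x)
  have hψd : MDifferentiableAt I' 𝓘(ℝ, E') ψ c :=
    mdifferentiableAt_extChartAt (mem_chart_source H' c)
  have hd : ∀ᶠ q in 𝓝 (φ x, ψ c), DifferentiableAt ℝ f' q :=
    (hf2.eventually (by simp)).mono fun q hq => hq.differentiableAt (by simp)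
  have hA : DifferentiableAt ℝ (fderiv ℝ f') (φ x, ψ c) :=
    (hf2.fderiv_right (m := 1) (by norm_num)).differentiableAt (by simp)
  have h1 : (fun c' => mvfderiv I (fun x' => f (x', c')) x u) =ᶠ[𝓝 c]
      fun c' => fderiv ℝ f' (φ x, ψ c') (mvfderiv I φ x u, 0) := by
    have hc : Tendsto (fun c' => (φ x, ψ c')) (𝓝 c) (𝓝 (φ x, ψ c)) :=
      (continuousAt_const.prodMk (continuousAt_extChartAt (I := I') c))
    filter_upwards [hc.eventually hd, (chartAt H' c).open_source.mem_nhds (mem_chart_source H' c)]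
      with c' hc' hs
    have e : (fun x' => f (x', c')) =ᶠ[𝓝 x] fun x' => (fun z => f' (z, ψ c')) (φ x') := by
      filter_upwards [(chartAt H x).open_source.mem_nhds (mem_chart_source H x)] with x' hx'
      simp only [hf', hφ, hψ]
      rw [PartialEquiv.left_inv _ (by simpa using hx'), PartialEquiv.left_inv _ (by simpa using hs)]
    have hg : HasFDerivAt (fun z => f' (z, ψ c')) ((fderiv ℝ f' (φ x, ψ c')).comp
        (ContinuousLinearMap.inl ℝ E E')) (φ x) :=
      HasFDerivAt.comp (f := fun z => (z, ψ c')) (φ x) hc'.hasFDerivAt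
        (hasFDerivAt_prodMk_left (φ x) (ψ c'))
    rw [e.mvfderiv_eq, mvfderiv_comp_fderiv_apply (g := fun z => f' (z, ψ c')) x
      hg.differentiableAt hφd, hg.fderiv]
    rfl
  have h2 : (fun x' => mvfderiv I' (fun c' => f (x', c')) c v) =ᶠ[𝓝 x]
      fun x' => fderiv ℝ f' (φ x', ψ c) (0, mvfderiv I' ψ c v) := by
    have hc : Tendsto (fun x' => (φ x', ψ c)) (𝓝 x) (𝓝 (φ x, ψ c)) :=
      ((continuousAt_extChartAt (I := I) x).prodMk continuousAt_const)
    filter_upwards [hc.eventually hd, (chartAt H x).open_source.mem_nhds (mem_chart_source H x)]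
      with x' hx' hs
    have e : (fun c' => f (x', c')) =ᶠ[𝓝 c] fun c' => (fun w => f' (φ x', w)) (ψ c') := by
      filter_upwards [(chartAt H' c).open_source.mem_nhds (mem_chart_source H' c)] with c' hc'
      simp only [hf', hφ, hψ]
      rw [PartialEquiv.left_inv _ (by simpa using hs), PartialEquiv.left_inv _ (by simpa using hc')]
    have hg : HasFDerivAt (fun w => f' (φ x', w)) ((fderiv ℝ f' (φ x', ψ c)).comp
        (ContinuousLinearMap.inr ℝ E E')) (ψ c) :=
      HasFDerivAt.comp (ψ c) hx'.hasFDerivAt (hasFDerivAt_prodMk_right (φ x') (ψ c))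
    rw [e.mvfderiv_eq, mvfderiv_comp_fderiv_apply (g := fun w => f' (φ x', w)) c
      hg.differentiableAt hψd, hg.fderiv]
    rfl
  have g1 : HasFDerivAt (fun w => fderiv ℝ f' (φ x, w) (mvfderiv I φ x u, 0))
      (((fderiv ℝ (fderiv ℝ f') (φ x, ψ c)).comp (ContinuousLinearMap.inr ℝ E E')).flip
        (mvfderiv I φ x u, 0)) (ψ c) := by
    have := HasFDerivAt.comp (ψ c) hA.hasFDerivAt (hasFDerivAt_prodMk_right (φ x) (ψ c))
    have h := this.clm_apply (hasFDerivAt_const ((mvfderiv I φ x u, 0) : E × E') (ψ c))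
    simpa using h
  have g2 : HasFDerivAt (fun z => fderiv ℝ f' (z, ψ c) (0, mvfderiv I' ψ c v))
      (((fderiv ℝ (fderiv ℝ f') (φ x, ψ c)).comp (ContinuousLinearMap.inl ℝ E E')).flip
        (0, mvfderiv I' ψ c v)) (φ x) := by
    have := HasFDerivAt.comp (f := fun z => (z, ψ c)) (φ x) hA.hasFDerivAt
      (hasFDerivAt_prodMk_left (φ x) (ψ c))
    have h := this.clm_apply (hasFDerivAt_const ((0, mvfderiv I' ψ c v) : E × E') (φ x))
    simpa using h
  have hsymm : IsSymmSndFDerivAt ℝ f' (φ x, ψ c) := hf2.isSymmSndFDerivAt (by simp)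
  rw [h1.mvfderiv_eq, h2.mvfderiv_eq,
    mvfderiv_comp_fderiv_apply (g := fun w => fderiv ℝ f' (φ x, w) (mvfderiv I φ x u, 0)) c
      g1.differentiableAt hψd,
    mvfderiv_comp_fderiv_apply (g := fun z => fderiv ℝ f' (z, ψ c) (0, mvfderiv I' ψ c v)) x
      g2.differentiableAt hφd, g1.fderiv, g2.fderiv]
  exact hsymm.eq _ _

end

/-! ### The tangent bundle of a tangent bundle, and the tangent Lie group -/

section

variable {E : Type*} [NormedAddCommGroup E] [NormedSpace ℝ E]
  {H : Type*} [TopologicalSpace H] {I : ModelWithCorners ℝ E H}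
  {M : Type*} [TopologicalSpace M] [ChartedSpace H M]
  {F : Type*} [NormedAddCommGroup F] [NormedSpace ℝ F]
  [IsManifold I 1 M]

theorem extChartAt_tangentBundle_eventuallyEq (p : TangentBundle I M) :
    extChartAt I.tangent p =ᶠ[𝓝 p]
      fun q => (extChartAt I p.1 q.1, mvfderiv I (extChartAt I p.1) q.1 q.2) := by
  have hs : (chartAt (ModelProd H E) p).source ∈ 𝓝 p :=
    (chartAt (ModelProd H E) p).open_source.mem_nhds (mem_chart_source _ p)
  filter_upwards [hs] with q hq
  rw [TangentBundle.mem_chart_source_iff] at hq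
  rw [← trivializationAt_tangent_snd hq]
  have : extChartAt I.tangent p = _ := FiberBundle.extChartAt (IB := I) p
  rw [this]
  rfl

variable [IsManifold I 2 M]

/-- A vector `u ∈ T_p TM`, which is stored as an element of `E × E`, has the components `u (φ ∘ π)`
and `u (dφ)`, where `φ` is the preferred chart at the base point of `p`. -/
theorem mvfderiv_proj_mvfderiv_extChartAt (p : TangentBundle I M) (u : TangentSpace I.tangent p) :
    ((mvfderiv I.tangent (fun q : TangentBundle I M => extChartAt I p.1 q.1) p u,
      mvfderiv I.tangent (fun q : TangentBundle I M => mvfderiv I (extChartAt I p.1) q.1 q.2) p u) :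
      E × E) = u := by
  have h := mvfderiv_extChartAt_self (I := I.tangent) p u
  refine Eq.trans ?_ h
  have hd : MDifferentiableAt I.tangent 𝓘(ℝ, E × E) (extChartAt I.tangent p) p :=
    mdifferentiableAt_extChartAt (mem_chart_source _ p)
  have e := extChartAt_tangentBundle_eventuallyEq p
  rw [e.mvfderiv_eq]
  have hd' := hd.congr_of_eventuallyEq e.symm
  refine Prod.ext ?_ ?_
  · have := mvfderiv_comp_fderiv_apply (g := Prod.fst) p differentiableAt_fst hd' u
    rw [fderiv_fst] at this
    exact this
  · have := mvfderiv_comp_fderiv_apply (g := Prod.snd) p differentiableAt_snd hd' u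
    rw [fderiv_snd] at this
    exact this

/-- Tangent vectors of `TM` agree if they agree on the functions `φ ∘ π` and `dφ`, where `φ` is the
preferred chart of `M`. -/
theorem tangentBundle_tangent_ext {p : TangentBundle I M} {u v : TangentSpace I.tangent p}
    (h1 : mvfderiv I.tangent (fun q : TangentBundle I M => extChartAt I p.1 q.1) p u =
      mvfderiv I.tangent (fun q : TangentBundle I M => extChartAt I p.1 q.1) p v)
    (h2 : mvfderiv I.tangent
        (fun q : TangentBundle I M => mvfderiv I (extChartAt I p.1) q.1 q.2) p u =
      mvfderiv I.tangent (fun q : TangentBundle I M => mvfderiv I (extChartAt I p.1) q.1 q.2) p v) :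
    u = v := by
  refine (mvfderiv_proj_mvfderiv_extChartAt p u).symm.trans ?_
  refine Eq.trans ?_ (mvfderiv_proj_mvfderiv_extChartAt p v)
  rw [h1, h2]

end

section

variable {E : Type*} [NormedAddCommGroup E] [NormedSpace ℝ E]
  {H : Type*} [TopologicalSpace H] {I : ModelWithCorners ℝ E H}
  {G : Type*} [TopologicalSpace G] [ChartedSpace H G] [Group G] [LieGroup I ∞ G]

/-- The multiplication of `TG` is the tangent map of that of `G`. -/
theorem tangentMul_eq_tangentMap (p q : TangentBundle I G) :
    p * q = tangentMap (I.prod I) I (fun z : G × G => z.1 * z.2)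
      ((equivTangentBundleProd I G I G).symm (p, q)) := by
  have hμ : MDifferentiableAt (I.prod I) I (fun z : G × G => z.1 * z.2) (p.1, q.1) :=
    (contMDiff_mul I ∞).contMDiffAt.mdifferentiableAt (by simp)
  have e := mfderiv_prod_eq_add_apply hμ (v := ((p.2, q.2) : E × E))
  refine TangentBundle.ext_coord rfl ?_
  refine Eq.trans ?_ e.symm
  exact add_comm (G := E) _ _

/-- The tangent group is a Lie group. It is not a global instance, since it would give a second way
to find the manifold structure of `TG`. -/
theorem tangentLieGroup : LieGroup I.tangent ∞ (TangentBundle I G) where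
  contMDiff_mul := by
    have h : ContMDiff (I.prod I).tangent I.tangent ∞
        (tangentMap (I.prod I) I (fun z : G × G => z.1 * z.2)) :=
      (contMDiff_mul I ∞).contMDiff_tangentMap (by simp)
    have h2 := h.comp (contMDiff_equivTangentBundleProd_symm (I := I) (M := G) (I' := I) (M' := G))
    refine h2.congr fun q => tangentMul_eq_tangentMap q.1 q.2
  contMDiff_inv := (contMDiff_inv I ∞).contMDiff_tangentMap (by simp)

/-- The smoothness class required by the Lie algebra of a Lie group. -/
theorem lieGroupMinSmoothness : LieGroup I (minSmoothness ℝ 3) G := by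
  rw [minSmoothness_of_isRCLikeNormedField]
  exact LieGroup.of_le (n := ∞) ENat.LEInfty.out

end

attribute [local instance] tangentLieGroup lieGroupMinSmoothness

/-! ### Vertical and complete lifts as derivations -/

section

variable {E : Type*} [NormedAddCommGroup E] [NormedSpace ℝ E]
  {H : Type*} [TopologicalSpace H] {I : ModelWithCorners ℝ E H}
  {M : Type*} [TopologicalSpace M] [ChartedSpace H M]
  {E' : Type*} [NormedAddCommGroup E'] [NormedSpace ℝ E']
  {H' : Type*} [TopologicalSpace H'] {I' : ModelWithCorners ℝ E' H'}
  {M' : Type*} [TopologicalSpace M'] [ChartedSpace H' M']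
  {F : Type*} [NormedAddCommGroup F] [NormedSpace ℝ F]

/-- The chain rule, with the base point of the outer function up to a propositional equality. -/
theorem mvfderiv_comp_mfderiv_apply_of_eq {g : M' → F} {f : M → M'} {x : M} {y : M'}
    (hg : MDifferentiableAt I' 𝓘(ℝ, F) g y) (hf : MDifferentiableAt I I' f x) (h : f x = y)
    (v : TangentSpace I x) :
    mvfderiv I (fun y => g (f y)) x v = mvfderiv I' g y (mfderiv I I' f x v) := by
  subst h
  exact mvfderiv_comp_mfderiv_apply x hg hf v

section

variable [IsManifold I 1 M]

theorem mdifferentiableAt_fiberLine (p : TangentBundle I M) (w : TangentSpace I p.1) (t : ℝ) :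
    MDifferentiableAt 𝓘(ℝ, ℝ) I.tangent
      (fun t : ℝ => (⟨p.1, p.2 + t • w⟩ : TangentBundle I M)) t := by
  rw [mdifferentiableAt_totalSpace]
  refine ⟨mdifferentiableAt_const, ?_⟩
  have : (fun t : ℝ => (trivializationAt E (TangentSpace I) p.1
      (⟨p.1, p.2 + t • w⟩ : TangentBundle I M)).2) =
      fun t : ℝ => mvfderiv I (extChartAt I p.1) p.1 p.2 +
        t • mvfderiv I (extChartAt I p.1) p.1 w := by
    ext t
    rw [trivializationAt_tangent_snd (p := ⟨p.1, p.2 + t • w⟩) (mem_chart_source H p.1)]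
    simp only [map_add, map_smul]
  simp only [this]
  apply DifferentiableAt.mdifferentiableAt
  fun_prop

/-- `X^v (g ∘ π) = 0`. -/
theorem mvfderiv_comp_proj_verticalLift {g : M → F} {X : (x : M) → TangentSpace I x}
    {p : TangentBundle I M} (hg : MDifferentiableAt I 𝓘(ℝ, F) g p.1) :
    mvfderiv I.tangent (fun q : TangentBundle I M => g q.1) p (verticalLift X p) = 0 := by
  have hd : MDifferentiableAt I.tangent 𝓘(ℝ, F) (fun q : TangentBundle I M => g q.1) p :=
    hg.comp p (mdifferentiableAt_proj (TangentSpace I))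
  refine (mvfderiv_comp_mfderiv_apply_of_eq hd (mdifferentiableAt_fiberLine p (X p.1) 0)
    (by simp) (1 : ℝ)).symm.trans ?_
  exact congrArg (fun L : ℝ →L[ℝ] F => L 1)
    (mvfderiv_const (I := 𝓘(ℝ, ℝ)) (g p.1) (x := (0 : ℝ)))

/-- `X^v (dg) = (X g) ∘ π`. -/
theorem mvfderiv_mvfderiv_verticalLift {g : M → F} {X : (x : M) → TangentSpace I x}
    {p : TangentBundle I M} (hg : MDifferentiableAt I.tangent 𝓘(ℝ, F)
      (fun q : TangentBundle I M => mvfderiv I g q.1 q.2) p) :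
    mvfderiv I.tangent (fun q : TangentBundle I M => mvfderiv I g q.1 q.2) p (verticalLift X p) =
      mvfderiv I g p.1 (X p.1) := by
  refine (mvfderiv_comp_mfderiv_apply_of_eq hg (mdifferentiableAt_fiberLine p (X p.1) 0)
    (by simp) (1 : ℝ)).symm.trans ?_
  have : (fun t : ℝ => mvfderiv I g p.1 (p.2 + t • X p.1)) = fun t : ℝ =>
      (fun s : ℝ => mvfderiv I g p.1 p.2 + s • mvfderiv I g p.1 (X p.1)) (id t) := by
    ext t
    simp
  have hd : HasDerivAt (fun s : ℝ => mvfderiv I g p.1 p.2 + s • mvfderiv I g p.1 (X p.1))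
      (mvfderiv I g p.1 (X p.1)) 0 := by
    simpa using ((hasDerivAt_id (0 : ℝ)).smul_const (mvfderiv I g p.1 (X p.1))).const_add
      (mvfderiv I g p.1 p.2)
  have h1 := mvfderiv_comp_fderiv_apply (I := 𝓘(ℝ, ℝ)) (f := id) (0 : ℝ)
    hd.differentiableAt mdifferentiableAt_id (1 : ℝ)
  refine (congrArg (fun f : ℝ → F => mvfderiv 𝓘(ℝ, ℝ) f 0 (1 : ℝ)) this).trans (h1.trans ?_)
  have h2 : mvfderiv 𝓘(ℝ, ℝ) (id : ℝ → ℝ) 0 (1 : ℝ) = 1 :=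
    congrArg (fun L : ℝ →L[ℝ] ℝ => L 1) (mfderiv_id (I := 𝓘(ℝ, ℝ)) (x := (0 : ℝ)))
  refine (congrArg (fun s : ℝ => fderiv ℝ (fun s : ℝ =>
    mvfderiv I g p.1 p.2 + s • mvfderiv I g p.1 (X p.1)) 0 s) h2).trans ?_
  exact hd.hasFDerivAt.fderiv ▸ (by simp)

variable [IsManifold I 2 M]

theorem mdifferentiableAt_mvfderiv_extChartAt (p : TangentBundle I M) (q : TangentBundle I M)
    (hq : q.1 ∈ (chartAt H p.1).source) :
    MDifferentiableAt I.tangent 𝓘(ℝ, E)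
      (fun q : TangentBundle I M => mvfderiv I (extChartAt I p.1) q.1 q.2) q :=
  ((contMDiffAt_extChartAt' (n := 2) hq).mvfderiv_tangentBundle (m := 1)
    (by norm_num)).mdifferentiableAt (by simp)

/-- The vertical lift in coordinates: `X^v = (0, X)`. -/
theorem verticalLift_eq (X : (x : M) → TangentSpace I x) (p : TangentBundle I M) :
    verticalLift X p = ((0, X p.1) : E × E) := by
  refine (mvfderiv_proj_mvfderiv_extChartAt p _).symm.trans ?_
  rw [mvfderiv_comp_proj_verticalLift (mdifferentiableAt_extChartAt (mem_chart_source H p.1)),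
    mvfderiv_mvfderiv_verticalLift
      (mdifferentiableAt_mvfderiv_extChartAt p p (mem_chart_source H p.1))]
  exact Prod.ext rfl (mvfderiv_extChartAt_self p.1 (X p.1))

/-- The complete lift in coordinates: `X^c = (X φ, d(X φ))` for the preferred chart `φ` at the base
point. -/
theorem completeLift_eq {X : (x : M) → TangentSpace I x} {p : TangentBundle I M}
    (hX : MDifferentiableAt I I.tangent (fun y => (⟨y, X y⟩ : TangentBundle I M)) p.1) :
    completeLift X p = ((mvfderiv I (extChartAt I p.1) p.1 (X p.1),
      mvfderiv I (fun x => mvfderiv I (extChartAt I p.1) x (X x)) p.1 p.2) : E × E) := by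
  refine Prod.ext (mvfderiv_extChartAt_self p.1 (X p.1)).symm ?_
  have h := mvfderiv_proj_mvfderiv_extChartAt (⟨p.1, X p.1⟩ : TangentBundle I M)
    (mfderiv I I.tangent (fun y => (⟨y, X y⟩ : TangentBundle I M)) p.1 p.2)
  refine (congrArg Prod.snd h).symm.trans ?_
  exact (mvfderiv_comp_mfderiv_apply
    (g := fun q : TangentBundle I M => mvfderiv I (extChartAt I p.1) q.1 q.2) p.1
    (mdifferentiableAt_mvfderiv_extChartAt p ⟨p.1, X p.1⟩ (mem_chart_source H p.1)) hX p.2).symm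

end

end

/-! ### Lifts of left-invariant fields are left-invariant -/

section

variable {E : Type*} [NormedAddCommGroup E] [NormedSpace ℝ E]
  {H : Type*} [TopologicalSpace H] {I : ModelWithCorners ℝ E H}
  {G : Type*} [TopologicalSpace G] [ChartedSpace H G] [Group G] [LieGroup I ∞ G]
  {F : Type*} [NormedAddCommGroup F] [NormedSpace ℝ F]

/-- The vector `(0, X)` of `T_{0_e} TG = E × E`, the velocity at `t = 0` of the curve `t ↦ tX` in
`T_e G`. -/
def verticalVector (X : GroupLieAlgebra I G) : GroupLieAlgebra I.tangent (TangentBundle I G) :=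
  ((0, X) : E × E)

/-- The vector `(X, 0)` of `T_{0_e} TG = E × E`, the image of `X` under the zero section of `TG`. -/
def completeVector (X : GroupLieAlgebra I G) : GroupLieAlgebra I.tangent (TangentBundle I G) :=
  ((X, 0) : E × E)

theorem mfderiv_fiberLine_one (X : GroupLieAlgebra I G) :
    mfderiv 𝓘(ℝ, ℝ) I.tangent (fun t : ℝ => (⟨1, t • X⟩ : TangentBundle I G)) 0 (1 : ℝ) =
      verticalVector X := by
  have h := verticalLift_eq (I := I) (fun _ : G => (X : E)) (1 : TangentBundle I G)
  refine Eq.trans ?_ h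
  exact congrArg (fun f : ℝ → TangentBundle I G => (mfderiv 𝓘(ℝ, ℝ) I.tangent f 0 (1 : ℝ) : E × E))
    (funext fun t => TangentBundle.ext_coord rfl (zero_add (M := E) _).symm)

theorem mfderiv_zeroSection_one (X : GroupLieAlgebra I G) :
    mfderiv I I.tangent (fun c : G => (⟨c, (0 : E)⟩ : TangentBundle I G)) 1 X =
      completeVector X := by
  have h := TangentBundle.tangentMap_tangentBundle_pure (I := I) (⟨1, X⟩ : TangentBundle I G)
  exact congrArg (fun q : TangentBundle I.tangent (TangentBundle I G) => (q.2 : E × E)) h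

/-- Right multiplication by a zero vector `0_c` is the tangent map of the right translation by `c`.
-/
theorem mul_zero_vector (p : TangentBundle I G) (c : G) :
    p * (⟨c, (0 : E)⟩ : TangentBundle I G) = tangentMap I I (fun x : G => x * c) p := by
  refine TangentBundle.ext_coord rfl ?_
  have e2 : (mfderiv I I (fun x : G => p.1 * x) c (0 : E) : E) = 0 :=
    (mfderiv I I (fun x : G => p.1 * x) c).map_zero
  exact (congrArg₂ (fun s t : E => s + t) e2 rfl).trans (zero_add (M := E) _)

/-- Right multiplication by `X ∈ T_e G` is the translation of the fibres by the left-invariant field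
`X`. -/
theorem mul_fiber_one (p : TangentBundle I G) (X : GroupLieAlgebra I G) :
    p * (⟨1, X⟩ : TangentBundle I G) = ⟨p.1, p.2 + mulInvariantVectorField X p.1⟩ := by
  refine TangentBundle.ext_coord (mul_one p.1) ?_
  have e : (mfderiv I I (fun x : G => x * 1) p.1 p.2 : E) = p.2 :=
    mfderiv_apply_of_eq_id (funext mul_one) p.1 p.2
  refine (congrArg₂ (fun s t : E => s + t) rfl e).trans ?_
  exact add_comm (G := E) _ _

theorem liftV_eq_mulInvariantVectorField (X : GroupLieAlgebra I G) (p : TangentBundle I G) :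
    liftV X p = mulInvariantVectorField (verticalVector X) p := by
  have hf : (fun t : ℝ => (⟨p.1, p.2 + t • mulInvariantVectorField X p.1⟩ : TangentBundle I G)) =
      fun t : ℝ => p * (⟨1, t • X⟩ : TangentBundle I G) := by
    ext1 t
    rw [mul_fiber_one, mulInvariantVectorField_smul]
    rfl
  have hc : MDifferentiableAt 𝓘(ℝ, ℝ) I.tangent
      (fun t : ℝ => (⟨1, t • X⟩ : TangentBundle I G)) 0 := by
    have := mdifferentiableAt_fiberLine (I := I) (1 : TangentBundle I G) X 0
    refine this.congr_of_eventuallyEq (Eventually.of_forall fun t => ?_)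
    exact TangentBundle.ext_coord rfl (zero_add (M := E) _).symm
  have h0 : (⟨1, (0 : ℝ) • X⟩ : TangentBundle I G) = 1 :=
    TangentBundle.ext_coord rfl (zero_smul ℝ (X : E))
  have hm := mdifferentiableAt_mulLeft (I := I.tangent) p 1
  have h := mfderiv_comp_apply_of_eq (I'' := I.tangent) (0 : ℝ) hm hc h0 (1 : ℝ)
  have hv : mulInvariantVectorField (verticalVector X) p =
      mfderiv I.tangent I.tangent (fun q : TangentBundle I G => p * q) 1
        (mfderiv 𝓘(ℝ, ℝ) I.tangent (fun t : ℝ => (⟨1, t • X⟩ : TangentBundle I G)) 0 (1 : ℝ)) :=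
    congrArg (fun w : E × E =>
      (mfderiv I.tangent I.tangent (fun q : TangentBundle I G => p * q) 1 w : E × E))
      (mfderiv_fiberLine_one X).symm
  refine Eq.trans ?_ (h.trans hv.symm)
  exact congrArg (fun f : ℝ → TangentBundle I G =>
    (mfderiv 𝓘(ℝ, ℝ) I.tangent f 0 (1 : ℝ) : E × E)) hf

/-- The left-invariant field with value `(X, 0)` is the velocity of the right translations by zero
vectors, that is, of the tangent maps of the right translations of `G`. -/
theorem mulInvariantVectorField_completeVector (X : GroupLieAlgebra I G) (p : TangentBundle I G) :
    mulInvariantVectorField (completeVector X) p =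
      mfderiv I I.tangent (fun c : G => p * (⟨c, (0 : E)⟩ : TangentBundle I G)) 1 X := by
  have hc : MDifferentiableAt I I.tangent (fun c : G => (⟨c, (0 : E)⟩ : TangentBundle I G)) 1 :=
    mdifferentiableAt_zeroSection (𝕜 := ℝ) (E := (TangentSpace I : G → Type _)) (F := E)
  have hm := mdifferentiableAt_mulLeft (I := I.tangent) p 1
  have h := mfderiv_comp_apply_of_eq (I'' := I.tangent) (1 : G) hm hc rfl X
  refine Eq.trans ?_ h.symm
  exact congrArg (fun w : E × E =>
      (mfderiv I.tangent I.tangent (fun q : TangentBundle I G => p * q) 1 w : E × E))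
      (mfderiv_zeroSection_one X).symm

theorem mdifferentiableAt_mul_zero_vector (p : TangentBundle I G) (c : G) :
    MDifferentiableAt I I.tangent (fun c : G => p * (⟨c, (0 : E)⟩ : TangentBundle I G)) c :=
  (mdifferentiableAt_mulLeft (I := I.tangent) p ⟨c, (0 : E)⟩).comp c
    (mdifferentiableAt_zeroSection (𝕜 := ℝ) (E := (TangentSpace I : G → Type _)) (F := E))

theorem mul_zero_vector_one (p : TangentBundle I G) :
    p * (⟨1, (0 : E)⟩ : TangentBundle I G) = p := mul_one p

/-- `X^c (g ∘ π) = (X g) ∘ π`, for the left-invariant field with value `(X, 0)`. -/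
theorem mvfderiv_comp_proj_completeVector {g : G → F} {X : GroupLieAlgebra I G}
    {p : TangentBundle I G} (hg : MDifferentiableAt I 𝓘(ℝ, F) g p.1) :
    mvfderiv I.tangent (fun q : TangentBundle I G => g q.1) p
        (mulInvariantVectorField (completeVector X) p) =
      mvfderiv I g p.1 (mulInvariantVectorField X p.1) := by
  have hd : MDifferentiableAt I.tangent 𝓘(ℝ, F) (fun q : TangentBundle I G => g q.1) p :=
    hg.comp p (mdifferentiableAt_proj (TangentSpace I))
  rw [mulInvariantVectorField_completeVector]
  refine (mvfderiv_comp_mfderiv_apply_of_eq hd (mdifferentiableAt_mul_zero_vector p 1)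
    (mul_zero_vector_one p) X).symm.trans ?_
  exact mvfderiv_comp_mfderiv_apply_of_eq hg (mdifferentiableAt_mulLeft p.1 1)
    (mul_one p.1) X

/-- `X^c (dg) = d(X g)`, for the left-invariant field with value `(X, 0)`: this exchanges the
derivatives of `(x, c) ↦ g (x c)` in `x` and in `c`. -/
theorem mvfderiv_mvfderiv_completeVector {g : G → F} {X : GroupLieAlgebra I G} [I.Boundaryless]
    {p : TangentBundle I G} (hg : ContMDiffAt I 𝓘(ℝ, F) 2 g p.1) :
    mvfderiv I.tangent (fun q : TangentBundle I G => mvfderiv I g q.1 q.2) p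
        (mulInvariantVectorField (completeVector X) p) =
      mvfderiv I (fun x => mvfderiv I g x (mulInvariantVectorField X x)) p.1 p.2 := by
  have hd : MDifferentiableAt I.tangent 𝓘(ℝ, F)
      (fun q : TangentBundle I G => mvfderiv I g q.1 q.2) p :=
    (hg.mvfderiv_tangentBundle (m := 1) (by norm_num)).mdifferentiableAt (by simp)
  have hev : ∀ᶠ x in 𝓝 p.1, MDifferentiableAt I 𝓘(ℝ, F) g x :=
    ((contMDiffAt_iff_contMDiffAt_nhds (by simp)).1 hg).mono fun x hx =>
      hx.mdifferentiableAt (by simp)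
  rw [mulInvariantVectorField_completeVector]
  refine (mvfderiv_comp_mfderiv_apply_of_eq hd (mdifferentiableAt_mul_zero_vector p 1)
    (mul_zero_vector_one p) X).symm.trans ?_
  have hcont : ContinuousAt (fun c : G => p.1 * c) 1 :=
    (contMDiff_mul_left (I := I) (n := ∞) (a := p.1)).continuous.continuousAt
  have h1 : (fun c : G => mvfderiv I g (p * (⟨c, (0 : E)⟩ : TangentBundle I G)).1
        (p * (⟨c, (0 : E)⟩ : TangentBundle I G)).2) =ᶠ[𝓝 1]
      fun c => mvfderiv I (fun x => g (x * c)) p.1 p.2 := by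
    have : Tendsto (fun c : G => p.1 * c) (𝓝 1) (𝓝 p.1) := by
      simpa [ContinuousAt] using hcont
    filter_upwards [this.eventually hev] with c hc
    rw [mul_zero_vector]
    exact (mvfderiv_comp_mfderiv_apply p.1 hc (mdifferentiableAt_mulRight c p.1) p.2).symm
  have h2 : (fun x => mvfderiv I (fun c => g (x * c)) 1 X) =ᶠ[𝓝 p.1]
      fun x => mvfderiv I g x (mulInvariantVectorField X x) := by
    filter_upwards [hev] with x hx
    exact mvfderiv_comp_mfderiv_apply_of_eq hx (mdifferentiableAt_mulLeft x 1)
      (mul_one x) X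
  rw [h1.mvfderiv_eq, ← h2.mvfderiv_eq]
  have hm : ContMDiffAt (I.prod I) 𝓘(ℝ, F) 2 (fun z : G × G => g (z.1 * z.2)) (p.1, 1) := by
    refine ContMDiffAt.comp_of_eq (y := p.1) hg ?_ (mul_one p.1)
    exact (contMDiff_mul I 2).contMDiffAt
  exact mvfderiv_mvfderiv_comm hm p.2 X

/-- The same as `mdifferentiableAt_mulInvariantVectorField`, with the vector field as an explicit
section. -/
theorem mdifferentiableAt_mulInvariantVectorField' (X : GroupLieAlgebra I G) (x : G) :
    MDifferentiableAt I I.tangent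
      (fun y => (⟨y, mulInvariantVectorField X y⟩ : TangentBundle I G)) x :=
  mdifferentiableAt_mulInvariantVectorField X

theorem liftC_eq_mulInvariantVectorField [I.Boundaryless] (X : GroupLieAlgebra I G)
    (p : TangentBundle I G) :
    liftC X p = mulInvariantVectorField (completeVector X) p := by
  refine (completeLift_eq (mdifferentiableAt_mulInvariantVectorField' X p.1)).trans ?_
  refine Eq.trans ?_ (mvfderiv_proj_mvfderiv_extChartAt p _)
  rw [mvfderiv_comp_proj_completeVector (mdifferentiableAt_extChartAt (mem_chart_source H p.1)),
    mvfderiv_mvfderiv_completeVector contMDiffAt_extChartAt]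

end

/-! ### Brackets of lifts -/

section

variable {E : Type*} [NormedAddCommGroup E] [NormedSpace ℝ E]
  {H : Type*} [TopologicalSpace H] {I : ModelWithCorners ℝ E H}
  {G : Type*} [TopologicalSpace G] [ChartedSpace H G] [Group G] [LieGroup I ∞ G]
  {F : Type*} [NormedAddCommGroup F] [NormedSpace ℝ F]

theorem liftV_eq (X : GroupLieAlgebra I G) :
    liftV X = mulInvariantVectorField (verticalVector X) :=
  funext (liftV_eq_mulInvariantVectorField X)

theorem mdifferentiableAt_liftV (X : GroupLieAlgebra I G) (p : TangentBundle I G) :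
    MDifferentiableAt I.tangent I.tangent.tangent
      (fun q => (⟨q, liftV X q⟩ : TangentBundle I.tangent (TangentBundle I G))) p := by
  rw [liftV_eq]
  exact mdifferentiableAt_mulInvariantVectorField' _ p

theorem ContMDiffAt.eventually_proj {g : G → F} {p : TangentBundle I G} {n : WithTop ℕ∞}
    (hn : n ≠ ∞) [IsManifold I n G] (hg : ContMDiffAt I 𝓘(ℝ, F) n g p.1) :
    ∀ᶠ q : TangentBundle I G in 𝓝 p, ContMDiffAt I 𝓘(ℝ, F) n g q.1 :=
  (FiberBundle.continuous_proj E (TangentSpace I : G → Type _)).continuousAt.eventually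
    ((contMDiffAt_iff_contMDiffAt_nhds hn).1 hg)

theorem ContMDiffAt.mvfderiv_mulInvariantVectorField {g : G → F} {x : G} {m n : WithTop ℕ∞}
    (hg : ContMDiffAt I 𝓘(ℝ, F) n g x) (hmn : m + 1 ≤ n) (hm : m ≤ 2) (X : GroupLieAlgebra I G) :
    ContMDiffAt I 𝓘(ℝ, F) m (fun x => mvfderiv I g x (mulInvariantVectorField X x)) x := by
  have h := (contMDiffAt_mulInvariantVectorField X (g := x)).of_le (m := m) (by simpa using hm)
  exact ContMDiffAt.comp (g := fun q : TangentBundle I G => mvfderiv I g q.1 q.2) x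
    (hg.mvfderiv_tangentBundle hmn) h

theorem ContMDiffAt.comp_proj {g : G → F} {p : TangentBundle I G}
    (hg : ContMDiffAt I 𝓘(ℝ, F) 2 g p.1) :
    ContMDiffAt I.tangent 𝓘(ℝ, F) 2 (fun q : TangentBundle I G => g q.1) p :=
  hg.comp p (contMDiffAt_proj (TangentSpace I))

variable {g : G → F} {p : TangentBundle I G} (X Y : GroupLieAlgebra I G)

theorem eventually_mvfderiv_proj_liftV (hg : ContMDiffAt I 𝓘(ℝ, F) 2 g p.1) :
    (fun q => mvfderiv I.tangent (fun q : TangentBundle I G => g q.1) q (liftV X q)) =ᶠ[𝓝 p]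
      fun _ => 0 := by
  filter_upwards [hg.eventually_proj (by simp)] with q hq
  exact mvfderiv_comp_proj_verticalLift (hq.mdifferentiableAt (by simp))

theorem eventually_mvfderiv_mvfderiv_liftV (hg : ContMDiffAt I 𝓘(ℝ, F) 2 g p.1) :
    (fun q => mvfderiv I.tangent (fun q : TangentBundle I G => mvfderiv I g q.1 q.2) q (liftV X q))
      =ᶠ[𝓝 p] fun q => mvfderiv I g q.1 (mulInvariantVectorField X q.1) := by
  filter_upwards [hg.eventually_proj (by simp)] with q hq
  exact mvfderiv_mvfderiv_verticalLift
    ((hq.mvfderiv_tangentBundle (m := 1) (by norm_num)).mdifferentiableAt (by simp))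

variable [I.Boundaryless]

theorem liftC_eq :
    liftC X = mulInvariantVectorField (completeVector X) :=
  funext (liftC_eq_mulInvariantVectorField X)

theorem mdifferentiableAt_liftC (p : TangentBundle I G) :
    MDifferentiableAt I.tangent I.tangent.tangent
      (fun q => (⟨q, liftC X q⟩ : TangentBundle I.tangent (TangentBundle I G))) p := by
  rw [liftC_eq]
  exact mdifferentiableAt_mulInvariantVectorField' _ p

theorem eventually_mvfderiv_proj_liftC (hg : ContMDiffAt I 𝓘(ℝ, F) 2 g p.1) :
    (fun q => mvfderiv I.tangent (fun q : TangentBundle I G => g q.1) q (liftC X q)) =ᶠ[𝓝 p]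
      fun q => mvfderiv I g q.1 (mulInvariantVectorField X q.1) := by
  filter_upwards [hg.eventually_proj (by simp)] with q hq
  rw [liftC_eq]
  exact mvfderiv_comp_proj_completeVector (hq.mdifferentiableAt (by simp))

theorem eventually_mvfderiv_mvfderiv_liftC (hg : ContMDiffAt I 𝓘(ℝ, F) 2 g p.1) :
    (fun q => mvfderiv I.tangent (fun q : TangentBundle I G => mvfderiv I g q.1 q.2) q (liftC X q))
      =ᶠ[𝓝 p]
      fun q => mvfderiv I (fun x => mvfderiv I g x (mulInvariantVectorField X x)) q.1 q.2 := by
  filter_upwards [hg.eventually_proj (by simp)] with q hq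
  rw [liftC_eq]
  exact mvfderiv_mvfderiv_completeVector hq

theorem mlieBracket_liftV_liftV (p : TangentBundle I G) :
    mlieBracket I.tangent (liftV X) (liftV Y) p = 0 := by
  have hφ : ContMDiffAt I 𝓘(ℝ, E) 3 (extChartAt I p.1) p.1 := contMDiffAt_extChartAt
  have hφ2 := hφ.of_le (m := 2) (by norm_num)
  have hX := (hφ.mvfderiv_mulInvariantVectorField (m := 2) (by norm_num) le_rfl
    X).mdifferentiableAt (by simp)
  have hY := (hφ.mvfderiv_mulInvariantVectorField (m := 2) (by norm_num) le_rfl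
    Y).mdifferentiableAt (by simp)
  apply tangentBundle_tangent_ext
  · rw [mvfderiv_mlieBracket hφ2.comp_proj (mdifferentiableAt_liftV X p)
        (mdifferentiableAt_liftV Y p),
      (eventually_mvfderiv_proj_liftV X hφ2).mvfderiv_eq,
      (eventually_mvfderiv_proj_liftV Y hφ2).mvfderiv_eq, mvfderiv_const]
    simp
  · rw [mvfderiv_mlieBracket (hφ.mvfderiv_tangentBundle (by norm_num))
        (mdifferentiableAt_liftV X p) (mdifferentiableAt_liftV Y p),
      (eventually_mvfderiv_mvfderiv_liftV X hφ2).mvfderiv_eq,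
      (eventually_mvfderiv_mvfderiv_liftV Y hφ2).mvfderiv_eq]
    rw [liftV, liftV, mvfderiv_comp_proj_verticalLift hX, mvfderiv_comp_proj_verticalLift hY]
    simp

variable [CompleteSpace E]

/-- `[X, Y] g = X (Y g) - Y (X g)` for left-invariant vector fields. -/
theorem mvfderiv_lie {x : G} (hg : ContMDiffAt I 𝓘(ℝ, F) 2 g x) :
    mvfderiv I g x (mulInvariantVectorField ⁅X, Y⁆ x) =
      mvfderiv I (fun y => mvfderiv I g y (mulInvariantVectorField Y y)) x
        (mulInvariantVectorField X x) -
      mvfderiv I (fun y => mvfderiv I g y (mulInvariantVectorField X y)) x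
        (mulInvariantVectorField Y x) := by
  rw [GroupLieAlgebra.bracket_def, mulInvariantVector_mlieBracket]
  exact mvfderiv_mlieBracket hg (mdifferentiableAt_mulInvariantVectorField' X x)
    (mdifferentiableAt_mulInvariantVectorField' Y x)

theorem mlieBracket_liftC_liftV (p : TangentBundle I G) :
    mlieBracket I.tangent (liftC X) (liftV Y) p = liftV ⁅X, Y⁆ p := by
  have hφ : ContMDiffAt I 𝓘(ℝ, E) 3 (extChartAt I p.1) p.1 := contMDiffAt_extChartAt
  have hφ2 := hφ.of_le (m := 2) (by norm_num)
  have hX := hφ.mvfderiv_mulInvariantVectorField (m := 2) (by norm_num) le_rfl X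
  have hY := hφ.mvfderiv_mulInvariantVectorField (m := 2) (by norm_num) le_rfl Y
  apply tangentBundle_tangent_ext
  · rw [mvfderiv_mlieBracket hφ2.comp_proj (mdifferentiableAt_liftC X p)
        (mdifferentiableAt_liftV Y p),
      (eventually_mvfderiv_proj_liftC X hφ2).mvfderiv_eq,
      (eventually_mvfderiv_proj_liftV Y hφ2).mvfderiv_eq, mvfderiv_const,
      (eventually_mvfderiv_proj_liftV Y hX).eq_of_nhds,
      (eventually_mvfderiv_proj_liftV _ hφ2).eq_of_nhds]
    simp
  · rw [mvfderiv_mlieBracket (hφ.mvfderiv_tangentBundle (by norm_num))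
        (mdifferentiableAt_liftC X p) (mdifferentiableAt_liftV Y p),
      (eventually_mvfderiv_mvfderiv_liftC X hφ2).mvfderiv_eq,
      (eventually_mvfderiv_mvfderiv_liftV Y hφ2).mvfderiv_eq,
      (eventually_mvfderiv_proj_liftC X hY).eq_of_nhds,
      (eventually_mvfderiv_mvfderiv_liftV Y hX).eq_of_nhds,
      (eventually_mvfderiv_mvfderiv_liftV _ hφ2).eq_of_nhds, mvfderiv_lie X Y hφ2]

theorem mlieBracket_liftC_liftC (p : TangentBundle I G) :
    mlieBracket I.tangent (liftC X) (liftC Y) p = liftC ⁅X, Y⁆ p := by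
  have hφ : ContMDiffAt I 𝓘(ℝ, E) 3 (extChartAt I p.1) p.1 := contMDiffAt_extChartAt
  have hφ2 := hφ.of_le (m := 2) (by norm_num)
  have hX := hφ.mvfderiv_mulInvariantVectorField (m := 2) (by norm_num) le_rfl X
  have hY := hφ.mvfderiv_mulInvariantVectorField (m := 2) (by norm_num) le_rfl Y
  apply tangentBundle_tangent_ext
  · rw [mvfderiv_mlieBracket hφ2.comp_proj (mdifferentiableAt_liftC X p)
        (mdifferentiableAt_liftC Y p),
      (eventually_mvfderiv_proj_liftC X hφ2).mvfderiv_eq,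
      (eventually_mvfderiv_proj_liftC Y hφ2).mvfderiv_eq,
      (eventually_mvfderiv_proj_liftC Y hX).eq_of_nhds,
      (eventually_mvfderiv_proj_liftC X hY).eq_of_nhds,
      (eventually_mvfderiv_proj_liftC _ hφ2).eq_of_nhds, mvfderiv_lie X Y hφ2]
  · have hXY := (hY.mvfderiv_mulInvariantVectorField (m := 1) (by norm_num) (by norm_num)
      X).mdifferentiableAt (by simp)
    have hYX := (hX.mvfderiv_mulInvariantVectorField (m := 1) (by norm_num) (by norm_num)
      Y).mdifferentiableAt (by simp)
    have hbr : (fun x => mvfderiv I (extChartAt I p.1) x (mulInvariantVectorField ⁅X, Y⁆ x))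
        =ᶠ[𝓝 p.1] _ := ((contMDiffAt_iff_contMDiffAt_nhds (by simp)).1 hφ2).mono
          fun x hx => mvfderiv_lie X Y hx
    rw [mvfderiv_mlieBracket (hφ.mvfderiv_tangentBundle (by norm_num))
        (mdifferentiableAt_liftC X p) (mdifferentiableAt_liftC Y p),
      (eventually_mvfderiv_mvfderiv_liftC X hφ2).mvfderiv_eq,
      (eventually_mvfderiv_mvfderiv_liftC Y hφ2).mvfderiv_eq,
      (eventually_mvfderiv_mvfderiv_liftC X hY).eq_of_nhds,
      (eventually_mvfderiv_mvfderiv_liftC Y hX).eq_of_nhds,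
      (eventually_mvfderiv_mvfderiv_liftC _ hφ2).eq_of_nhds, hbr.mvfderiv_eq,
      mvfderiv_fun_sub hXY hYX]
    rfl

/-- The tangent map of the section `s_Y : G → TG` of a left-invariant field `Y` satisfies `T s_Y (X)
= X^c + [X, Y]^v`: both sides send `dg` to `X (Y g) = Y (X g) + [X, Y] g`. -/
theorem mfderiv_mulInvariantVectorField (x : G) :
    mfderiv I I.tangent (fun y => (⟨y, mulInvariantVectorField Y y⟩ : TangentBundle I G)) x
      (mulInvariantVectorField X x) =
      liftC X ⟨x, mulInvariantVectorField Y x⟩ + liftV ⁅X, Y⁆ ⟨x, mulInvariantVectorField Y x⟩ := by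
  have hφ : ContMDiffAt I 𝓘(ℝ, E) 3 (extChartAt I x) x := contMDiffAt_extChartAt
  have hφ2 := hφ.of_le (m := 2) (by norm_num)
  have hs := mdifferentiableAt_mulInvariantVectorField' Y x
  apply tangentBundle_tangent_ext
  · rw [← mvfderiv_comp_mfderiv_apply x (hφ2.comp_proj.mdifferentiableAt (by simp)) hs, map_add,
      (eventually_mvfderiv_proj_liftC _ hφ2).eq_of_nhds,
      (eventually_mvfderiv_proj_liftV _ hφ2).eq_of_nhds, add_zero]
  · rw [← mvfderiv_comp_mfderiv_apply x ((hφ.mvfderiv_tangentBundle (m := 2)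
        (by norm_num)).mdifferentiableAt (by simp)) hs, map_add,
      (eventually_mvfderiv_mvfderiv_liftC _ hφ2).eq_of_nhds,
      (eventually_mvfderiv_mvfderiv_liftV _ hφ2).eq_of_nhds, mvfderiv_lie X Y hφ2]
    abel

end

/-! ### Bi-invariant metrics -/

section

variable {E : Type*} [NormedAddCommGroup E] [NormedSpace ℝ E]
  {H : Type*} [TopologicalSpace H] {I : ModelWithCorners ℝ E H}

section

variable {M : Type*} [TopologicalSpace M] [ChartedSpace H M] [IsManifold I ∞ M]

theorem SmoothMetric.mdifferentiableAt_inner_self (g : SmoothMetric I M) (p : TangentBundle I M) :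
    MDifferentiableAt I.tangent 𝓘(ℝ, ℝ) (fun q : TangentBundle I M => g.inner q.1 q.2 q.2) p := by
  have hg : ContMDiffAt I (I.prod 𝓘(ℝ, E →L[ℝ] E →L[ℝ] ℝ)) ∞
    (fun b ↦ TotalSpace.mk' (E →L[ℝ] E →L[ℝ] ℝ) b (g.inner b)) p.1 := g.contMDiff.contMDiffAt
  have hb : ContMDiffAt I.tangent I ∞ (fun q : TangentBundle I M => q.1) p :=
    contMDiffAt_proj (TangentSpace I)
  have hv : ContMDiffAt I.tangent I.tangent ∞
      (fun q : TangentBundle I M => (⟨q.1, q.2⟩ : TangentBundle I M)) p := contMDiffAt_id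
  have : ContMDiffAt I.tangent (I.prod 𝓘(ℝ)) ∞
      (fun m : TangentBundle I M ↦ TotalSpace.mk' ℝ (E := Bundle.Trivial M ℝ) m.1
        (g.inner m.1 m.2 m.2)) p := by
    apply ContMDiffAt.clm_bundle_apply₂ (F₁ := E) (F₂ := E)
    · exact hg.comp p hb
    · exact hv
    · exact hv
  rw [contMDiffAt_totalSpace] at this
  exact this.2.mdifferentiableAt (by simp)

/-- The derivative of the quadratic form of `g` along `X^v` is `2 g(y, X)` at `y`. -/
theorem SmoothMetric.mvfderiv_inner_self_verticalLift (g : SmoothMetric I M)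
    (X : (x : M) → TangentSpace I x) (p : TangentBundle I M) :
    mvfderiv I.tangent (fun q : TangentBundle I M => g.inner q.1 q.2 q.2) p (verticalLift X p) =
      2 * g.inner p.1 p.2 (X p.1) := by
  refine (mvfderiv_comp_mfderiv_apply_of_eq (g.mdifferentiableAt_inner_self p)
    (mdifferentiableAt_fiberLine p (X p.1) 0) (by simp) (1 : ℝ)).symm.trans ?_
  have h : (fun t : ℝ => g.inner p.1 (p.2 + t • X p.1) (p.2 + t • X p.1)) = fun t : ℝ =>
      g.inner p.1 p.2 p.2 + t * (2 * g.inner p.1 p.2 (X p.1)) +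
        t ^ 2 * g.inner p.1 (X p.1) (X p.1) := by
    ext t
    simp only [map_add, map_smul, add_apply, smul_apply,
      smul_eq_mul, g.symm p.1 (X p.1) p.2]
    ring
  have hd : HasDerivAt (fun t : ℝ => g.inner p.1 (p.2 + t • X p.1) (p.2 + t • X p.1))
      (2 * g.inner p.1 p.2 (X p.1)) 0 := by
    rw [h]
    have h1 := ((hasDerivAt_id (0 : ℝ)).mul_const (2 * g.inner p.1 p.2 (X p.1))).const_add
      (g.inner p.1 p.2 p.2)
    have h2 := ((hasDerivAt_id (0 : ℝ)).pow 2).mul_const (g.inner p.1 (X p.1) (X p.1))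
    exact (h1.add h2).congr_deriv (by simp)
  have e := mfderiv_eq_fderiv (𝕜 := ℝ)
    (f := fun t : ℝ => g.inner p.1 (p.2 + t • X p.1) (p.2 + t • X p.1)) (x := 0)
  refine (congrArg (fun L : ℝ →L[ℝ] ℝ => L 1) e).trans ?_
  rw [hd.hasFDerivAt.fderiv]
  simp

end

variable {G : Type*} [TopologicalSpace G] [ChartedSpace H G] [Group G] [LieGroup I ∞ G]

/-- Change of the base point along an equality; the vectors are elements of the model space, in
which all tangent spaces are stored. -/
theorem SmoothMetric.inner_congr {M : Type*} [TopologicalSpace M] [ChartedSpace H M]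
    [IsManifold I 1 M] (g : SmoothMetric I M) {x y : M} (h : x = y) (u v : E) :
    (g.inner x : E →L[ℝ] E →L[ℝ] ℝ) u v = (g.inner y : E →L[ℝ] E →L[ℝ] ℝ) u v := by
  subst h; rfl

theorem SmoothMetric.IsLeftInvariant.inner_mulInvariantVectorField {g : SmoothMetric I G}
    (hg : g.IsLeftInvariant) (X Y : GroupLieAlgebra I G) (x : G) :
    g.inner x (mulInvariantVectorField X x) (mulInvariantVectorField Y x) = g.inner 1 X Y :=
  (g.inner_congr (mul_one x).symm _ _).trans (hg x 1 X Y)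

variable [I.Boundaryless] [CompleteSpace E]

/-- `g(Y, [X, Y]) = 0`: the quadratic form of `g` is annihilated by `X^c` and constant along `s_Y`,
and `T s_Y (X) = X^c + [X, Y]^v`. -/
theorem SmoothMetric.IsBiInvariant.inner_bracket_self {g : SmoothMetric I G}
    (hg : g.IsBiInvariant) (X Y : GroupLieAlgebra I G) (x : G) :
    g.inner x (mulInvariantVectorField Y x) (mulInvariantVectorField ⁅X, Y⁆ x) = 0 := by
  set p : TangentBundle I G := ⟨x, mulInvariantVectorField Y x⟩ with hp
  have hN := g.mdifferentiableAt_inner_self p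
  have h1 : mvfderiv I.tangent (fun q : TangentBundle I G => g.inner q.1 q.2 q.2) p
      (liftC X p) = 0 := by
    rw [liftC_eq, mulInvariantVectorField_completeVector]
    refine (mvfderiv_comp_mfderiv_apply_of_eq hN (mdifferentiableAt_mul_zero_vector p 1)
      (mul_zero_vector_one p) X).symm.trans ?_
    have : (fun c : G => g.inner (p * (⟨c, (0 : E)⟩ : TangentBundle I G)).1
        (p * (⟨c, (0 : E)⟩ : TangentBundle I G)).2 (p * (⟨c, (0 : E)⟩ : TangentBundle I G)).2) =
        fun _ => g.inner p.1 p.2 p.2 := by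
      ext c
      rw [mul_zero_vector]
      exact hg.2 c p.1 p.2 p.2
    rw [this, mvfderiv_const]
    rfl
  have h2 := g.mvfderiv_inner_self_verticalLift (mulInvariantVectorField ⁅X, Y⁆) p
  have h3 := mvfderiv_comp_mfderiv_apply x hN (mdifferentiableAt_mulInvariantVectorField' Y x)
    (mulInvariantVectorField X x)
  rw [mfderiv_mulInvariantVectorField, map_add] at h3
  have h4 : (fun y => g.inner y (mulInvariantVectorField Y y) (mulInvariantVectorField Y y)) =
      fun _ => g.inner 1 Y Y := by
    ext y
    exact hg.1.inner_mulInvariantVectorField Y Y y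
  have h5 : mvfderiv I (fun y => g.inner y (mulInvariantVectorField Y y)
      (mulInvariantVectorField Y y)) x (mulInvariantVectorField X x) = 0 := by
    rw [h4, mvfderiv_const]; rfl
  have h6 := h3.symm.trans h5
  have h7 := (congrArg₂ (· + ·) h1 h2).symm.trans h6
  simpa using h7

/-- For a bi-invariant metric `ad X` is skew-symmetric. -/
theorem SmoothMetric.IsBiInvariant.inner_bracket_add {g : SmoothMetric I G}
    (hg : g.IsBiInvariant) (X Y Z : GroupLieAlgebra I G) (x : G) :
    g.inner x (mulInvariantVectorField ⁅X, Y⁆ x) (mulInvariantVectorField Z x) +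
      g.inner x (mulInvariantVectorField Y x) (mulInvariantVectorField ⁅X, Z⁆ x) = 0 := by
  have h := hg.inner_bracket_self X (Y + Z) x
  have hY := hg.inner_bracket_self X Y x
  have hZ := hg.inner_bracket_self X Z x
  simp only [lie_add, mulInvariantVectorField_add, Pi.add_apply, map_add,
    add_apply] at h
  rw [g.symm x (mulInvariantVectorField ⁅X, Y⁆ x) (mulInvariantVectorField Z x)]
  linarith

end

/-! ### Uniqueness of the lifted metric and its Levi-Civita connection -/

section

variable {E : Type*} [NormedAddCommGroup E] [NormedSpace ℝ E]
  {H : Type*} [TopologicalSpace H] {I : ModelWithCorners ℝ E H}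

theorem SmoothMetric.eq_of_inner_eq {M : Type*} [TopologicalSpace M] [ChartedSpace H M]
    [IsManifold I 1 M] (g : SmoothMetric I M) {x : M} {u v : TangentSpace I x}
    (h : ∀ w : TangentSpace I x, g.inner x u w = g.inner x v w) : u = v := by
  by_contra hne
  have := g.pos x (u - v) (sub_ne_zero.2 hne)
  have e : g.inner x (u - v) (u - v) = g.inner x u (u - v) - g.inner x v (u - v) :=
    congrArg (fun L : TangentSpace I x →L[ℝ] ℝ => L (u - v)) (map_sub (g.inner x) u v)
  rw [e, h, sub_self] at this
  exact lt_irrefl _ this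

/-- The Koszul formula for three vector fields with constant scalar products. -/
theorem IsLeviCivita.koszul [FiniteDimensional ℝ E] {M : Type*} [TopologicalSpace M]
    [ChartedSpace H M] [IsManifold I 1 M] [IsManifold I 2 M] {g : SmoothMetric I M}
    {cov : CovariantDerivative I E (TangentSpace I : M → Type _)} (h : IsLeviCivita g cov)
    {A B C : (y : M) → TangentSpace I y} {x : M}
    (hA : MDifferentiableAt I I.tangent (fun y => (⟨y, A y⟩ : TangentBundle I M)) x)
    (hB : MDifferentiableAt I I.tangent (fun y => (⟨y, B y⟩ : TangentBundle I M)) x)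
    (hC : MDifferentiableAt I I.tangent (fun y => (⟨y, C y⟩ : TangentBundle I M)) x)
    {a b c : ℝ} (hBC : ∀ y, g.inner y (B y) (C y) = a) (hCA : ∀ y, g.inner y (C y) (A y) = b)
    (hAB : ∀ y, g.inner y (A y) (B y) = c) :
    2 * g.inner x (cov B x (A x)) (C x) = g.inner x (mlieBracket I A B x) (C x) -
      g.inner x (mlieBracket I B C x) (A x) + g.inner x (mlieBracket I C A x) (B x) := by
  have : CompleteSpace E := FiniteDimensional.complete ℝ E
  obtain ⟨ht, hm⟩ := h
  rw [CovariantDerivative.torsion_eq_zero_iff] at ht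
  have key {Y Z : (y : M) → TangentSpace I y}
      (hY : MDifferentiableAt I I.tangent (fun y => (⟨y, Y y⟩ : TangentBundle I M)) x)
      (hZ : MDifferentiableAt I I.tangent (fun y => (⟨y, Z y⟩ : TangentBundle I M)) x) {d : ℝ}
      (hd : ∀ y, g.inner y (Y y) (Z y) = d) (v : TangentSpace I x) :
      g.inner x (cov Y x v) (Z x) + g.inner x (Y x) (cov Z x v) = 0 := by
    rw [← hm x v Y Z hY hZ, funext hd, mfderiv_const]
    rfl
  have k1 := key hB hC hBC (A x)
  have k2 := key hC hA hCA (B x)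
  have k3 := key hA hB hAB (C x)
  rw [← ht hA hB, ← ht hB hC, ← ht hC hA]
  simp only [map_sub, sub_apply]
  have s1 := g.symm x (B x) (cov C x (A x))
  have s2 := g.symm x (C x) (cov A x (B x))
  have s3 := g.symm x (A x) (cov B x (C x))
  linarith

variable {G : Type*} [TopologicalSpace G] [ChartedSpace H G] [Group G] [LieGroup I ∞ G]

theorem mulInvariantVectorField_surjective {x : G} (u : TangentSpace I x) :
    ∃ X : GroupLieAlgebra I G, mulInvariantVectorField X x = u := by
  refine ⟨(mfderiv I I (fun y : G => x⁻¹ * y) x u : E), ?_⟩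
  have h := mfderiv_comp_apply_of_eq (I'' := I) x (mdifferentiableAt_mulLeft (I := I) x 1)
    (mdifferentiableAt_mulLeft x⁻¹ x) (inv_mul_cancel x) u
  refine h.symm.trans ?_
  exact mfderiv_apply_of_eq_id (I := I) (by ext y; simp) x u

theorem exists_completeVector_add_verticalVector
    (w : GroupLieAlgebra I.tangent (TangentBundle I G)) :
    ∃ X Y : GroupLieAlgebra I G, w = completeVector X + verticalVector Y :=
  ⟨(w : E × E).1, (w : E × E).2,
    Prod.ext (add_zero (M := E) _).symm (zero_add (M := E) _).symm⟩

theorem IsLiftedMetric.vertical_complete {g₁ g₂ : SmoothMetric I G}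
    {gt : SmoothMetric I.tangent (TangentBundle I G)} (h : IsLiftedMetric g₁ g₂ gt)
    (X Y : GroupLieAlgebra I G) (p : TangentBundle I G) :
    gt.inner p (liftV X p) (liftC Y p) = 0 := by
  rw [gt.symm, h.complete_vertical]

variable [I.Boundaryless]

theorem exists_liftC_add_liftV {p : TangentBundle I G} (u : TangentSpace I.tangent p) :
    ∃ X Y : GroupLieAlgebra I G, u = liftC X p + liftV Y p := by
  obtain ⟨w, hw⟩ := mulInvariantVectorField_surjective u
  obtain ⟨X, Y, rfl⟩ := exists_completeVector_add_verticalVector w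
  refine ⟨X, Y, ?_⟩
  rw [liftC_eq, liftV_eq, ← hw, mulInvariantVectorField_add, Pi.add_apply]

theorem IsLiftedMetric.unique {g₁ g₂ : SmoothMetric I G}
    {gt gt' : SmoothMetric I.tangent (TangentBundle I G)} (h : IsLiftedMetric g₁ g₂ gt)
    (h' : IsLiftedMetric g₁ g₂ gt') : gt = gt' := by
  have : gt.inner = gt'.inner := by
    funext p
    ext u v
    obtain ⟨X, Y, rfl⟩ := exists_liftC_add_liftV u
    obtain ⟨X', Y', rfl⟩ := exists_liftC_add_liftV v
    simp only [map_add, add_apply, h.complete_complete, h.complete_vertical, h.vertical_vertical,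
      h.vertical_complete, h'.complete_complete, h'.complete_vertical, h'.vertical_vertical,
      h'.vertical_complete]
  cases gt; cases gt'
  cases this
  rfl

theorem SmoothMetric.eq_of_inner_lift_eq {gt : SmoothMetric I.tangent (TangentBundle I G)}
    {p : TangentBundle I G} {u v : TangentSpace I.tangent p}
    (hc : ∀ Z : GroupLieAlgebra I G, gt.inner p u (liftC Z p) = gt.inner p v (liftC Z p))
    (hv : ∀ Z : GroupLieAlgebra I G, gt.inner p u (liftV Z p) = gt.inner p v (liftV Z p)) :
    u = v := by
  refine gt.eq_of_inner_eq fun w => ?_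
  obtain ⟨X, Y, rfl⟩ := exists_liftC_add_liftV w
  rw [map_add, map_add, hc, hv]

theorem IsLiftedMetric.cov_formulas [FiniteDimensional ℝ E] {g₁ g₂ : SmoothMetric I G}
    (h₁ : g₁.IsBiInvariant) (h₂ : g₂.IsBiInvariant)
    {gt : SmoothMetric I.tangent (TangentBundle I G)} (h : IsLiftedMetric g₁ g₂ gt)
    {cov : CovariantDerivative I.tangent (E × E)
      (TangentSpace I.tangent : TangentBundle I G → Type _)} (hcov : IsLeviCivita gt cov)
    (X Y : GroupLieAlgebra I G) (p : TangentBundle I G) :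
    cov (liftV Y) p (liftV X p) = 0 ∧
      cov (liftC Y) p (liftC X p) = (1 / 2 : ℝ) • liftC ⁅X, Y⁆ p ∧
      cov (liftC Y) p (liftV X p) = 0 ∧
      cov (liftV Y) p (liftC X p) = liftV ⁅X, Y⁆ p := by
  have : CompleteSpace E := FiniteDimensional.complete ℝ E
  have cc (X Y : GroupLieAlgebra I G) (q : TangentBundle I G) :
      gt.inner q (liftC X q) (liftC Y q) = g₁.inner 1 X Y := by
    rw [h.complete_complete, h₁.1.inner_mulInvariantVectorField]
  have vv (X Y : GroupLieAlgebra I G) (q : TangentBundle I G) :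
      gt.inner q (liftV X q) (liftV Y q) = g₂.inner 1 X Y := by
    rw [h.vertical_vertical, h₂.1.inner_mulInvariantVectorField]
  have cv (X Y : GroupLieAlgebra I G) (q : TangentBundle I G) := h.complete_vertical X Y q
  have vc (X Y : GroupLieAlgebra I G) (q : TangentBundle I G) := h.vertical_complete X Y q
  have bvv (X Y : GroupLieAlgebra I G) := mlieBracket_liftV_liftV X Y p
  have bcc (X Y : GroupLieAlgebra I G) := mlieBracket_liftC_liftC X Y p
  have bcv (X Y : GroupLieAlgebra I G) := mlieBracket_liftC_liftV X Y p
  have bvc (X Y : GroupLieAlgebra I G) : mlieBracket I.tangent (liftV X) (liftC Y) p =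
      - liftV ⁅Y, X⁆ p := by rw [mlieBracket_swap_apply, bcv]
  have s1 (X Y Z : GroupLieAlgebra I G) : g₁.inner 1 ⁅X, Y⁆ Z + g₁.inner 1 Y ⁅X, Z⁆ = 0 := by
    have := h₁.inner_bracket_add X Y Z 1
    rwa [h₁.1.inner_mulInvariantVectorField, h₁.1.inner_mulInvariantVectorField] at this
  have s2 (X Y Z : GroupLieAlgebra I G) : g₂.inner 1 ⁅X, Y⁆ Z + g₂.inner 1 Y ⁅X, Z⁆ = 0 := by
    have := h₂.inner_bracket_add X Y Z 1
    rwa [h₂.1.inner_mulInvariantVectorField, h₂.1.inner_mulInvariantVectorField] at this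
  have dv (X : GroupLieAlgebra I G) := mdifferentiableAt_liftV X p
  have dc (X : GroupLieAlgebra I G) := mdifferentiableAt_liftC X p
  -- Against `Z^c` every term of Koszul's formula is a product of a complete and a vertical lift;
  -- against `Z^v` the terms cancel by skew-symmetry of `ad Y`.
  have hvc : ∀ X Y : GroupLieAlgebra I G, cov (liftC Y) p (liftV X p) = 0 := by
    intro X Y
    refine SmoothMetric.eq_of_inner_lift_eq (gt := gt) (fun Z => ?_) fun Z => ?_
    · have k := hcov.koszul (dv X) (dc Y) (dc Z) (cc Y Z) (cv Z X) (vc X Y)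
      rw [bvc, bcc, bcv] at k
      simp only [map_neg, neg_apply, vc, cv] at k
      rw [map_zero, zero_apply]
      linarith
    · have k := hcov.koszul (dv X) (dc Y) (dv Z) (cv Y Z) (vv Z X) (vc X Y)
      rw [bvc, bcv, bvv] at k
      simp only [map_neg, neg_apply, vv, map_zero, zero_apply] at k
      rw [map_zero, zero_apply]
      have := s2 Y X Z
      have := g₂.symm 1 X ⁅Y, Z⁆
      linarith
  refine ⟨?_, ?_, hvc X Y, ?_⟩
  · refine SmoothMetric.eq_of_inner_lift_eq (gt := gt) (fun Z => ?_) fun Z => ?_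
    · have k := hcov.koszul (dv X) (dv Y) (dc Z) (vc Y Z) (cv Z X) (vv X Y)
      rw [bvv, bvc, bcv] at k
      simp only [map_neg, neg_apply, vv, map_zero, zero_apply] at k
      rw [map_zero, zero_apply]
      have := s2 Z X Y
      have := g₂.symm 1 X ⁅Z, Y⁆
      linarith
    · have k := hcov.koszul (dv X) (dv Y) (dv Z) (vv Y Z) (vv Z X) (vv X Y)
      rw [bvv, bvv, bvv] at k
      simp only [map_zero, zero_apply] at k
      rw [map_zero, zero_apply]
      linarith
  · refine SmoothMetric.eq_of_inner_lift_eq (gt := gt) (fun Z => ?_) fun Z => ?_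
    · have k := hcov.koszul (dc X) (dc Y) (dc Z) (cc Y Z) (cc Z X) (cc X Y)
      rw [bcc, bcc, bcc] at k
      simp only [cc] at k
      rw [map_smul, smul_apply, cc, smul_eq_mul]
      have a1 := s1 Z X Y
      have a2 := g₁.symm 1 X ⁅Z, Y⁆
      have a3 : g₁.inner 1 ⁅Y, Z⁆ X = - g₁.inner 1 ⁅Z, Y⁆ X := by
        rw [← lie_skew, map_neg, neg_apply]
      linarith
    · have k := hcov.koszul (dc X) (dc Y) (dv Z) (cv Y Z) (vc Z X) (cc X Y)
      rw [bcc, bcv, bvc] at k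
      simp only [map_neg, neg_apply, cv, vc] at k
      rw [map_smul, smul_apply, cv, smul_zero]
      linarith
  -- `∇_{X^c} Y^v = ∇_{Y^v} X^c + [X^c, Y^v]`, as the torsion vanishes.
  · have ht := (CovariantDerivative.torsion_eq_zero_iff cov).1 hcov.1 (dc X) (dv Y)
    rw [hvc, sub_zero, bcv] at ht
    exact ht

end

/-! ### Existence of the lifted metric -/

section

variable {E : Type*} [NormedAddCommGroup E] [NormedSpace ℝ E]
  {H : Type*} [TopologicalSpace H] {I : ModelWithCorners ℝ E H}

theorem isVonNBounded_of_posDef [FiniteDimensional ℝ E] (B : E →L[ℝ] E →L[ℝ] ℝ)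
    (hB : ∀ v, v ≠ 0 → 0 < B v v) : Bornology.IsVonNBounded ℝ {v : E | B v v < 1} := by
  have hc : Continuous fun v : E => B v v := B.continuous.clm_apply continuous_id
  -- `c` is the minimum of the quadratic form on the unit sphere, which is empty if `E = 0`.
  obtain ⟨c, hc0, hcs⟩ : ∃ c : ℝ, 0 < c ∧ ∀ v ∈ Metric.sphere (0 : E) 1, c ≤ B v v := by
    have : ProperSpace E := FiniteDimensional.proper ℝ E
    rcases (Metric.sphere (0 : E) 1).eq_empty_or_nonempty with h | h
    · exact ⟨1, one_pos, by simp [h]⟩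
    · obtain ⟨w, hw, hmin⟩ := (isCompact_sphere (0 : E) 1).exists_isMinOn h hc.continuousOn
      exact ⟨B w w, hB w (ne_zero_of_mem_unit_sphere ⟨w, hw⟩), fun v hv => hmin hv⟩
  rw [NormedSpace.isVonNBounded_iff']
  refine ⟨√(1 / c), fun v hv => Real.le_sqrt_of_sq_le ?_⟩
  rcases eq_or_ne v 0 with rfl | h0
  · simp [hc0.le]
  have hn : 0 < ‖v‖ := norm_pos_iff.2 h0
  have h1 := hcs (‖v‖⁻¹ • v) (by simp [norm_smul, hn.ne'])
  simp only [map_smul, smul_apply, smul_eq_mul] at h1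
  have hv' : B v v < 1 := hv
  rw [le_div_iff₀ hc0]
  have h2 : c * ‖v‖ ^ 2 ≤ B v v := by
    calc c * ‖v‖ ^ 2 ≤ ‖v‖⁻¹ * (‖v‖⁻¹ * B v v) * ‖v‖ ^ 2 := by gcongr
      _ = B v v := by field_simp
  linarith

section

variable {F : Type*} [NormedAddCommGroup F] [NormedSpace ℝ F]
variable {M : Type*} [TopologicalSpace M] [ChartedSpace H M] [IsManifold I 1 M]

/-- The metric `(u, v) ↦ B(D_x u, D_x v)`, where `B` is a scalar product on `F` and `D_x : T_x M →
F` is injective and depends smoothly on `x`. The smoothness of `D` is expressed in the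
trivialization of `TM` over the chart at `x₀`. -/
def SmoothMetric.ofFrame [FiniteDimensional ℝ E] (B : F →L[ℝ] F →L[ℝ] ℝ)
    (symm : ∀ u v, B u v = B v u) (pos : ∀ v, v ≠ 0 → 0 < B v v)
    (D : (x : M) → TangentSpace I x →L[ℝ] F) (inj : ∀ x, Function.Injective (D x))
    (smooth : ∀ x₀ : M, ContMDiffAt I 𝓘(ℝ, E →L[ℝ] F) ∞ (fun x : M =>
      (D x).comp ((trivializationAt E (TangentSpace I) x₀).symmL ℝ x)) x₀) : SmoothMetric I M where
  inner x := ((D x).precomp ℝ).comp (B.comp (D x))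
  symm x v w := symm _ _
  pos x v hv := pos _ fun h => hv (inj x (h.trans (map_zero (D x)).symm))
  isVonNBounded x := isVonNBounded_of_posDef (E := E) (B.bilinearComp (D x) (D x))
    fun v hv => pos _ fun h => hv (inj x (h.trans (map_zero (D x)).symm))
  contMDiff := by
    intro x₀
    rw [contMDiffAt_section]
    have h : ContMDiffAt I 𝓘(ℝ, E →L[ℝ] E →L[ℝ] ℝ) ∞ (fun x : M =>
        B.bilinearComp ((D x).comp ((trivializationAt E (TangentSpace I) x₀).symmL ℝ x))
        ((D x).comp ((trivializationAt E (TangentSpace I) x₀).symmL ℝ x))) x₀ := by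
      have hΦ : ContDiff ℝ ∞ (fun A : E →L[ℝ] F => B.bilinearComp A A) := by
        have : (fun A : E →L[ℝ] F => B.bilinearComp A A) = fun A =>
            ((ContinuousLinearMap.compL ℝ E F ℝ).flip A).comp (B.comp A) := by
          ext A u v; rfl
        rw [this]
        exact (ContinuousLinearMap.contDiff _).clm_comp (contDiff_const.clm_comp contDiff_id)
      exact hΦ.contMDiff.contMDiffAt.comp x₀ (smooth x₀)
    refine h.congr_of_eventuallyEq ?_
    filter_upwards [(trivializationAt E (TangentSpace I : M → Type _) x₀).open_baseSet.mem_nhds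
      (mem_baseSet_trivializationAt E (TangentSpace I) x₀)] with x hx
    ext u v
    rw [hom_trivializationAt_apply]
    refine (inCoordinates_apply_eq₂ hx hx (Set.mem_univ _)).trans ?_
    have e (w : E) : (trivializationAt E (TangentSpace I) x₀).symm x w =
        (trivializationAt E (TangentSpace I) x₀).symmL ℝ x w :=
      (Trivialization.symmL_apply _ hx w).symm
    rw [e, e]
    simp

/-- The differential of a smooth function depends smoothly on the base point, in the form required
by `SmoothMetric.ofFrame`. -/
theorem ContMDiffAt.mvfderiv_comp_symmL {f : M → F} {x₀ : M} [IsManifold I ∞ M]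
    (hf : ContMDiffAt I 𝓘(ℝ, F) ∞ f x₀) :
    ContMDiffAt I 𝓘(ℝ, E →L[ℝ] F) ∞ (fun x : M =>
      (mvfderiv I f x).comp ((trivializationAt E (TangentSpace I) x₀).symmL ℝ x)) x₀ := by
  refine (hf.mfderiv_const (m := ∞) (by simp)).congr_of_eventuallyEq (.of_forall fun x => ?_)
  ext u
  simp only [inTangentCoordinates, ContinuousLinearMap.inCoordinates, id,
    TangentBundle.continuousLinearMapAt_model_space]
  rfl

end

variable {G : Type*} [TopologicalSpace G] [ChartedSpace H G] [Group G] [LieGroup I ∞ G]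

theorem continuousLinearMapAt_tangent_of_eq {M : Type*} [TopologicalSpace M] [ChartedSpace H M]
    [IsManifold I 1 M] {x y : M} (h : x = y) (u : E) :
    ((trivializationAt E (TangentSpace I) x).continuousLinearMapAt ℝ y u : E) = u := by
  subst h
  rw [TangentBundle.continuousLinearMapAt_trivializationAt_eq_core (mem_chart_source H x)]
  exact (tangentBundleCore I M).coordChange_self _ _ (mem_chart_source H x) _

theorem mfderiv_mul_left_inv_mulInvariantVectorField (x : G) (X : GroupLieAlgebra I G) :
    (mfderiv I I (fun y : G => x⁻¹ * y) x (mulInvariantVectorField X x) : E) = X := by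
  refine (mfderiv_comp_apply_of_eq (I'' := I) 1 (mdifferentiableAt_mulLeft (I := I) x⁻¹ x)
    (mdifferentiableAt_mulLeft x 1) (mul_one x) X).symm.trans ?_
  exact mfderiv_apply_of_eq_id (I := I) (by ext y; simp) 1 X

/-- The left-invariant metric with the value `B` at the unit; its value at `x` is the pullback of
`B` by the left translation by `x⁻¹`. -/
def SmoothMetric.leftInvariant [FiniteDimensional ℝ E] (B : E →L[ℝ] E →L[ℝ] ℝ)
    (symm : ∀ u v, B u v = B v u) (pos : ∀ v, v ≠ 0 → 0 < B v v) : SmoothMetric I G :=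
  .ofFrame B symm pos (fun x => (mfderiv I I (fun y : G => x⁻¹ * y) x : E →L[ℝ] E))
    (fun x u v h => by
      obtain ⟨X, rfl⟩ := mulInvariantVectorField_surjective u
      obtain ⟨Y, rfl⟩ := mulInvariantVectorField_surjective v
      have : X = Y := (mfderiv_mul_left_inv_mulInvariantVectorField x X).symm.trans
        (h.trans (mfderiv_mul_left_inv_mulInvariantVectorField x Y))
      rw [this])
    (fun x₀ => by
      have hf : ContMDiffAt (I.prod I) I ∞
          (Function.uncurry fun x y : G => x⁻¹ * y) (x₀, id x₀) :=
        (contMDiff_fst.inv.mul contMDiff_snd).contMDiffAt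
      refine (hf.mfderiv (fun x y : G => x⁻¹ * y) id (m := ∞) contMDiffAt_id
        (by simp)).congr_of_eventuallyEq (.of_forall fun x => ?_)
      ext u
      exact (continuousLinearMapAt_tangent_of_eq (I := I)
        ((inv_mul_cancel x₀).trans (inv_mul_cancel x).symm) _).symm)

theorem SmoothMetric.leftInvariant_inner_mulInvariantVectorField [FiniteDimensional ℝ E]
    (B : E →L[ℝ] E →L[ℝ] ℝ)
    (symm : ∀ u v, B u v = B v u) (pos : ∀ v, v ≠ 0 → 0 < B v v) (X Y : GroupLieAlgebra I G)
    (x : G) : (leftInvariant B symm pos : SmoothMetric I G).inner x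
      (mulInvariantVectorField X x) (mulInvariantVectorField Y x) = B X Y :=
  congrArg₂ (fun u v : E => B u v) (mfderiv_mul_left_inv_mulInvariantVectorField x X)
    (mfderiv_mul_left_inv_mulInvariantVectorField x Y)

theorem mfderiv_mul_left_mulInvariantVectorField (a x : G) (X : GroupLieAlgebra I G) :
    (mfderiv I I (fun y : G => a * y) x (mulInvariantVectorField X x) : E) =
      mulInvariantVectorField X (a * x) := by
  refine (mfderiv_comp_apply_of_eq (I'' := I) 1 (mdifferentiableAt_mulLeft (I := I) a x)
    (mdifferentiableAt_mulLeft x 1) (mul_one x) X).symm.trans ?_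
  have : (fun y : G => a * y) ∘ (fun y : G => x * y) = fun y : G => a * x * y := by
    ext y; simp [mul_assoc]
  rw [this]
  rfl

theorem SmoothMetric.isLeftInvariant_leftInvariant [FiniteDimensional ℝ E]
    (B : E →L[ℝ] E →L[ℝ] ℝ)
    (symm : ∀ u v, B u v = B v u) (pos : ∀ v, v ≠ 0 → 0 < B v v) :
    (leftInvariant B symm pos : SmoothMetric I G).IsLeftInvariant := by
  intro a x u v
  obtain ⟨X, rfl⟩ := mulInvariantVectorField_surjective u
  obtain ⟨Y, rfl⟩ := mulInvariantVectorField_surjective v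
  rw [leftInvariant_inner_mulInvariantVectorField]
  refine Eq.trans ?_ (leftInvariant_inner_mulInvariantVectorField B symm pos X Y (a * x))
  exact congrArg₂ (fun u v : E => ((leftInvariant B symm pos : SmoothMetric I G).inner (a * x) :
    E →L[ℝ] E →L[ℝ] ℝ) u v) (mfderiv_mul_left_mulInvariantVectorField a x X)
    (mfderiv_mul_left_mulInvariantVectorField a x Y)

/-- The scalar product at `0_e` is the orthogonal sum of `g₁` on the first factor of `E × E` and
`g₂` on the second. -/
theorem exists_isLiftedMetric [I.Boundaryless] [FiniteDimensional ℝ E] {g₁ g₂ : SmoothMetric I G}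
    (h₁ : g₁.IsLeftInvariant) (h₂ : g₂.IsLeftInvariant) :
    ∃ gt : SmoothMetric I.tangent (TangentBundle I G), IsLiftedMetric g₁ g₂ gt := by
  let b₁ : E →L[ℝ] E →L[ℝ] ℝ := g₁.inner 1
  let b₂ : E →L[ℝ] E →L[ℝ] ℝ := g₂.inner 1
  have s₁ (u v : E) : b₁ u v = b₁ v u := g₁.symm 1 u v
  have s₂ (u v : E) : b₂ u v = b₂ v u := g₂.symm 1 u v
  have p₁ (u : E) (h : u ≠ 0) : 0 < b₁ u u := g₁.pos 1 u h
  have p₂ (u : E) (h : u ≠ 0) : 0 < b₂ u u := g₂.pos 1 u h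
  have n₁ (u : E) : 0 ≤ b₁ u u := by
    rcases eq_or_ne u 0 with rfl | h
    · simp
    · exact (p₁ u h).le
  have n₂ (u : E) : 0 ≤ b₂ u u := by
    rcases eq_or_ne u 0 with rfl | h
    · simp
    · exact (p₂ u h).le
  let B : (E × E) →L[ℝ] (E × E) →L[ℝ] ℝ :=
    b₁.bilinearComp (.fst ℝ E E) (.fst ℝ E E) + b₂.bilinearComp (.snd ℝ E E) (.snd ℝ E E)
  have hBa (u v : E × E) : B u v = b₁ u.1 v.1 + b₂ u.2 v.2 := rfl
  have symm (u v : E × E) : B u v = B v u := by rw [hBa, hBa, s₁, s₂]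
  have pos (u : E × E) (h : u ≠ 0) : 0 < B u u := by
    rw [hBa]
    by_cases h1 : u.1 = 0
    · exact add_pos_of_nonneg_of_pos (n₁ _) (p₂ _ fun h2 => h (Prod.ext h1 h2))
    · exact add_pos_of_pos_of_nonneg (p₁ _ h1) (n₂ _)
  refine ⟨.leftInvariant B symm pos, SmoothMetric.isLeftInvariant_leftInvariant B symm pos,
    fun X Y p => ?_, fun X Y p => ?_, fun X Y p => ?_⟩
  · rw [liftC_eq, liftC_eq, SmoothMetric.leftInvariant_inner_mulInvariantVectorField,
      h₁.inner_mulInvariantVectorField]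
    refine (hBa _ _).trans ?_
    exact (congrArg (b₁ X Y + ·) (by simp : b₂ (0 : E) (0 : E) = 0)).trans (add_zero _)
  · rw [liftV_eq, liftV_eq, SmoothMetric.leftInvariant_inner_mulInvariantVectorField,
      h₂.inner_mulInvariantVectorField]
    refine (hBa _ _).trans ?_
    exact (congrArg (· + b₂ X Y) (by simp : b₁ (0 : E) (0 : E) = 0)).trans (zero_add _)
  · rw [liftC_eq, liftV_eq, SmoothMetric.leftInvariant_inner_mulInvariantVectorField]
    refine (hBa _ _).trans ?_
    exact (congrArg₂ (· + ·) (map_zero (b₁ X)) (b₂.map_zero₂ Y)).trans (add_zero _)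

end

/-! ### Right-invariance of the lifted metric -/

section

section

variable {E : Type*} [NormedAddCommGroup E] [NormedSpace ℝ E]
  {H : Type*} [TopologicalSpace H] {I : ModelWithCorners ℝ E H}
variable {G : Type*} [TopologicalSpace G] [ChartedSpace H G] [Group G]

theorem mulInvariantVectorField_one (X : GroupLieAlgebra I G) :
    (mulInvariantVectorField X 1 : E) = X :=
  mfderiv_apply_of_eq_id (funext one_mul) 1 X

variable [LieGroup I ∞ G]

theorem zero_vector_mul_fiber_one (X : GroupLieAlgebra I G) (c : G) :
    (⟨c, (0 : E)⟩ : TangentBundle I G) * (⟨1, X⟩ : TangentBundle I G) =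
      ⟨c, mulInvariantVectorField X c⟩ := by
  rw [mul_fiber_one]
  exact TangentBundle.ext_coord rfl (zero_add (M := E) _)

/-- Right translation by `Y ∈ T_e G` maps `(X, 0)` to `X^c + [X, Y]^v`, because it maps the zero
section to `s_Y`. -/
theorem mfderiv_mul_right_completeVector [I.Boundaryless] [CompleteSpace E]
    (X Y : GroupLieAlgebra I G) :
    (mfderiv I.tangent I.tangent (fun q : TangentBundle I G => q * ⟨1, Y⟩) 1 (completeVector X) :
      E × E) = ((liftC X ⟨1, mulInvariantVectorField Y 1⟩ : E × E) +
        (liftV ⁅X, Y⁆ ⟨1, mulInvariantVectorField Y 1⟩ : E × E)) := by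
  have hc : MDifferentiableAt I I.tangent (fun c : G => (⟨c, (0 : E)⟩ : TangentBundle I G)) 1 :=
    mdifferentiableAt_zeroSection (𝕜 := ℝ) (E := (TangentSpace I : G → Type _)) (F := E)
  have h := mfderiv_comp_apply_of_eq (I'' := I.tangent) (1 : G)
    (mdifferentiableAt_mulRight (I := I.tangent) (⟨1, Y⟩ : TangentBundle I G) 1) hc rfl X
  have h1 := congrArg (fun w : E × E => (mfderiv I.tangent I.tangent
    (fun q : TangentBundle I G => q * ⟨1, Y⟩) 1 w : E × E)) (mfderiv_zeroSection_one X)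
  refine (h.trans h1).symm.trans ?_
  have h2 : (fun q : TangentBundle I G => q * ⟨1, Y⟩) ∘
      (fun c : G => (⟨c, (0 : E)⟩ : TangentBundle I G)) =
      fun c => ⟨c, mulInvariantVectorField Y c⟩ :=
    funext (zero_vector_mul_fiber_one Y)
  refine (congrArg (fun f : G → TangentBundle I G =>
    (mfderiv I I.tangent f 1 X : E × E)) h2).trans ?_
  refine Eq.trans ?_ (mfderiv_mulInvariantVectorField X Y 1)
  exact congrArg (fun w : E => (mfderiv I I.tangent
    (fun y => (⟨y, mulInvariantVectorField Y y⟩ : TangentBundle I G)) 1 w : E × E))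
    (mulInvariantVectorField_one X).symm

/-- If the lifted metric is right-invariant, then the Lie algebra of `G` is abelian. -/
theorem IsLiftedMetric.lie_eq_zero_of_isRightInvariant [I.Boundaryless] [CompleteSpace E]
    {g₁ g₂ : SmoothMetric I G} {gt : SmoothMetric I.tangent (TangentBundle I G)}
    (h₁ : g₁.IsLeftInvariant) (h : IsLiftedMetric g₁ g₂ gt) (hr : gt.IsRightInvariant)
    (X Y : GroupLieAlgebra I G) : ⁅X, Y⁆ = 0 := by
  set p : TangentBundle I G := ⟨1, mulInvariantVectorField Y 1⟩ with hp
  have hb : 1 * (⟨1, Y⟩ : TangentBundle I G) = p :=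
    (one_mul _).trans (TangentBundle.ext_coord rfl (mulInvariantVectorField_one Y).symm)
  have e1 := hr ⟨1, Y⟩ 1 (completeVector X) (completeVector X)
  have e2 : gt.inner p (liftC X p + liftV ⁅X, Y⁆ p) (liftC X p + liftV ⁅X, Y⁆ p) =
      gt.inner 1 (completeVector X) (completeVector X) := by
    refine Eq.trans ?_ e1
    refine Eq.trans ?_ (gt.inner_congr hb _ _).symm
    exact congrArg (fun w : E × E => (gt.inner p : E × E →L[ℝ] E × E →L[ℝ] ℝ) w w)
      (mfderiv_mul_right_completeVector X Y).symm
  have e3 : gt.inner 1 (completeVector X) (completeVector X) = g₁.inner 1 X X := by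
    rw [← h₁.inner_mulInvariantVectorField X X 1]
    refine Eq.trans ?_ (h.complete_complete X X 1)
    rw [liftC_eq, h.leftInvariant.inner_mulInvariantVectorField]
  simp only [map_add, add_apply, h.complete_complete, h.complete_vertical, h.vertical_complete,
    h.vertical_vertical] at e2
  rw [e3, h₁.inner_mulInvariantVectorField] at e2
  by_contra hne
  have hpos := g₂.pos p.1 (mulInvariantVectorField ⁅X, Y⁆ p.1)
    (fun h0 => hne ((mulInvariantVectorField_one ⁅X, Y⁆).symm.trans h0))
  linarith
end

/-! ### The group of unit quaternions -/

section

open Quaternion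

instance fact_finrank_quaternion : Fact (Module.finrank ℝ ℍ[ℝ] = 3 + 1) :=
  ⟨Quaternion.finrank_eq_four⟩

/-- The group `S³` of unit quaternions. -/
abbrev UnitQuaternions : Type := Metric.sphere (0 : ℍ[ℝ]) 1

instance lieGroupUnitQuaternions : LieGroup (𝓡 3) ∞ UnitQuaternions where
  toIsManifold := EuclideanSpace.instIsManifoldSphere.of_le le_top
  contMDiff_mul := by
    apply ContMDiff.codRestrict_sphere
    have h : ContMDiff (𝓘(ℝ, ℍ[ℝ]).prod 𝓘(ℝ, ℍ[ℝ])) 𝓘(ℝ, ℍ[ℝ]) ∞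
        fun z : ℍ[ℝ] × ℍ[ℝ] => z.1 * z.2 := by
      rw [contMDiff_iff]
      exact ⟨continuous_mul, fun x y => contDiff_mul.contDiffOn⟩
    suffices h₁ : ContMDiff _ _ _ (Prod.map ((↑) : UnitQuaternions → ℍ[ℝ])
      ((↑) : UnitQuaternions → ℍ[ℝ])) from h.comp h₁
    apply ContMDiff.prodMap <;> exact contMDiff_coe_sphere
  contMDiff_inv := by
    apply ContMDiff.codRestrict_sphere
    intro x
    have hx := contDiffAt_ringInverse ℝ (n := ∞) (unitSphereToUnits ℍ[ℝ] x)
    rw [Ring.inverse_eq_inv'] at hx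
    exact hx.contMDiffAt.comp x contMDiff_coe_sphere.contMDiffAt

instance connectedSpace_unitQuaternions : ConnectedSpace UnitQuaternions :=
  Subtype.connectedSpace (isConnected_sphere
    (by rw [Quaternion.rank_eq_four]; norm_num) 0 zero_le_one)

/-- The differential of the inclusion of `S³` into the quaternions, which makes tangent vectors of
`S³` quaternions. -/
def quaternionVector {x : UnitQuaternions} : TangentSpace (𝓡 3) x →L[ℝ] ℍ[ℝ] :=
  mvfderiv (𝓡 3) ((↑) : UnitQuaternions → ℍ[ℝ]) x

theorem mdifferentiableAt_coe_unitQuaternions (x : UnitQuaternions) :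
    MDifferentiableAt (𝓡 3) 𝓘(ℝ, ℍ[ℝ]) ((↑) : UnitQuaternions → ℍ[ℝ]) x :=
  (contMDiff_coe_sphere (m := 1)).contMDiffAt.mdifferentiableAt (by simp)

theorem quaternionVector_mul_left (a x : UnitQuaternions) (u : TangentSpace (𝓡 3) x) :
    quaternionVector (mfderiv (𝓡 3) (𝓡 3) (fun y => a * y) x u) = a * quaternionVector u :=
  (mvfderiv_comp_mfderiv_apply x (mdifferentiableAt_coe_unitQuaternions _)
    (mdifferentiableAt_mulLeft a x) u).symm.trans <|
  ContinuousLinearMap.mvfderiv_comp_apply (ContinuousLinearMap.mul ℝ ℍ[ℝ] (a : ℍ[ℝ]))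
    (mdifferentiableAt_coe_unitQuaternions x) u

theorem quaternionVector_mul_right (a x : UnitQuaternions) (u : TangentSpace (𝓡 3) x) :
    quaternionVector (mfderiv (𝓡 3) (𝓡 3) (fun y => y * a) x u) = quaternionVector u * a :=
  (mvfderiv_comp_mfderiv_apply x (mdifferentiableAt_coe_unitQuaternions _)
    (mdifferentiableAt_mulRight a x) u).symm.trans <|
  ContinuousLinearMap.mvfderiv_comp_apply ((ContinuousLinearMap.mul ℝ ℍ[ℝ]).flip (a : ℍ[ℝ]))
    (mdifferentiableAt_coe_unitQuaternions x) u

/-- The metric on `S³` induced by the Euclidean scalar product of the quaternions. -/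
def roundMetric : SmoothMetric (𝓡 3) UnitQuaternions :=
  .ofFrame (innerSL ℝ) (fun u v => real_inner_comm v u) (fun _ hv => real_inner_self_pos.2 hv)
    (fun _ => quaternionVector) injective_mvfderiv_subtypeVal_sphere
    (fun x₀ => (contMDiff_coe_sphere x₀).mvfderiv_comp_symmL)

theorem roundMetric_inner {x : UnitQuaternions} (u v : TangentSpace (𝓡 3) x) :
    roundMetric.inner x u v = inner ℝ (quaternionVector u) (quaternionVector v) := rfl

theorem inner_unitQuaternion_mul_left (a : UnitQuaternions) (u v : ℍ[ℝ]) :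
    inner ℝ (a * u) (a * v) = inner ℝ u v := by
  have ha : ‖(a : ℍ[ℝ])‖ = 1 := by simp
  simp only [real_inner_eq_norm_mul_self_add_norm_mul_self_sub_norm_sub_mul_self_div_two,
    ← mul_sub, norm_mul, ha, one_mul]

theorem inner_unitQuaternion_mul_right (a : UnitQuaternions) (u v : ℍ[ℝ]) :
    inner ℝ (u * a) (v * a) = inner ℝ u v := by
  have ha : ‖(a : ℍ[ℝ])‖ = 1 := by simp
  simp only [real_inner_eq_norm_mul_self_add_norm_mul_self_sub_norm_sub_mul_self_div_two,
    ← sub_mul, norm_mul, ha, mul_one]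

theorem isBiInvariant_roundMetric : roundMetric.IsBiInvariant :=
  ⟨fun a x u v => by
    rw [roundMetric_inner, roundMetric_inner, quaternionVector_mul_left,
      quaternionVector_mul_left, inner_unitQuaternion_mul_left],
   fun a x u v => by
    rw [roundMetric_inner, roundMetric_inner, quaternionVector_mul_right,
      quaternionVector_mul_right, inner_unitQuaternion_mul_right]⟩

theorem quaternionVector_mulInvariantVectorField (X : GroupLieAlgebra (𝓡 3) UnitQuaternions)
    (x : UnitQuaternions) :
    quaternionVector (mulInvariantVectorField X x) = x * quaternionVector (x := 1) X := by
  refine Eq.trans ?_ (quaternionVector_mul_left x 1 X)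
  exact congrArg (fun y : UnitQuaternions => mvfderiv (𝓡 3) ((↑) : UnitQuaternions → ℍ[ℝ]) y
    (mulInvariantVectorField X x : EuclideanSpace ℝ (Fin 3))) (mul_one x).symm

/-- The Lie bracket of `S³` is the commutator of quaternions. -/
theorem quaternionVector_lie (X Y : GroupLieAlgebra (𝓡 3) UnitQuaternions) :
    quaternionVector (x := 1) ⁅X, Y⁆ = quaternionVector (x := 1) X * quaternionVector (x := 1) Y -
      quaternionVector (x := 1) Y * quaternionVector (x := 1) X := by
  have key (X Y : GroupLieAlgebra (𝓡 3) UnitQuaternions) :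
      mvfderiv (𝓡 3) (fun y : UnitQuaternions => mvfderiv (𝓡 3) ((↑) : UnitQuaternions → ℍ[ℝ]) y
        (mulInvariantVectorField Y y)) 1 (mulInvariantVectorField X 1) =
      quaternionVector (x := 1) X * quaternionVector (x := 1) Y := by
    have h1 : (fun y : UnitQuaternions => mvfderiv (𝓡 3) ((↑) : UnitQuaternions → ℍ[ℝ]) y
        (mulInvariantVectorField Y y)) = fun y : UnitQuaternions =>
        (ContinuousLinearMap.mul ℝ ℍ[ℝ]).flip (quaternionVector (x := 1) Y) (y : ℍ[ℝ]) :=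
      funext (quaternionVector_mulInvariantVectorField Y)
    rw [h1]
    refine (ContinuousLinearMap.mvfderiv_comp_apply ((ContinuousLinearMap.mul ℝ ℍ[ℝ]).flip
      (quaternionVector (x := 1) Y)) (mdifferentiableAt_coe_unitQuaternions 1) _).trans ?_
    have h2 := quaternionVector_mulInvariantVectorField X 1
    rw [Metric.unitSphere.coe_one, one_mul] at h2
    exact congrArg (· * quaternionVector (x := 1) Y) h2
  have h := mvfderiv_lie X Y (x := (1 : UnitQuaternions))
    (g := ((↑) : UnitQuaternions → ℍ[ℝ])) contMDiff_coe_sphere.contMDiffAt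
  rw [key, key] at h
  refine Eq.trans ?_ h
  have h2 := quaternionVector_mulInvariantVectorField ⁅X, Y⁆ 1
  rw [Metric.unitSphere.coe_one, one_mul] at h2
  exact h2.symm

/-- The Lie algebra of `S³` consists of the imaginary quaternions. -/
theorem exists_quaternionVector_eq {q : ℍ[ℝ]} (hq : q.re = 0) :
    ∃ X : GroupLieAlgebra (𝓡 3) UnitQuaternions, quaternionVector (x := 1) X = q := by
  have h : q ∈ (ℝ ∙ ((1 : UnitQuaternions) : ℍ[ℝ]))ᗮ := by
    rw [Submodule.mem_orthogonal_singleton_iff_inner_left, Quaternion.inner_def]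
    simpa using hq
  rw [← range_mvfderiv_subtypeVal (n := 3)] at h
  exact h

theorem exists_lie_ne_zero_unitQuaternions :
    ∃ X Y : GroupLieAlgebra (𝓡 3) UnitQuaternions, ⁅X, Y⁆ ≠ 0 := by
  obtain ⟨i, hi⟩ : ∃ i : ℍ[ℝ], i = ⟨0, 1, 0, 0⟩ := ⟨_, rfl⟩
  obtain ⟨j, hj⟩ : ∃ j : ℍ[ℝ], j = ⟨0, 0, 1, 0⟩ := ⟨_, rfl⟩
  obtain ⟨X, hX⟩ := exists_quaternionVector_eq (q := i) (by rw [hi])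
  obtain ⟨Y, hY⟩ := exists_quaternionVector_eq (q := j) (by rw [hj])
  refine ⟨X, Y, fun h0 => ?_⟩
  have h := quaternionVector_lie X Y
  rw [h0, hX, hY] at h
  have h1 : quaternionVector (x := (1 : UnitQuaternions)) 0 = 0 := map_zero _
  have h2 := congrArg (fun q : ℍ[ℝ] => q.imK) (h1.symm.trans h)
  simp only [Quaternion.imK_sub, Quaternion.imK_mul, Quaternion.imK_zero] at h2
  norm_num [hi, hj] at h2
end

theorem exists_isLiftedMetric_not_isBiInvariant :
    ∃ (n : ℕ) (G : Type) (_ : TopologicalSpace G) (_ : ChartedSpace (EuclideanSpace ℝ (Fin n)) G)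
      (_ : Group G) (_ : LieGroup (𝓡 n) ∞ G) (_ : ConnectedSpace G)
      (g₁ g₂ : SmoothMetric (𝓡 n) G)
      (gt : SmoothMetric (𝓡 n).tangent (TangentBundle (𝓡 n) G)),
      g₁.IsBiInvariant ∧ g₂.IsBiInvariant ∧ IsLiftedMetric g₁ g₂ gt ∧ ¬ gt.IsBiInvariant := by
  have hr := isBiInvariant_roundMetric
  obtain ⟨gt, hgt⟩ := exists_isLiftedMetric hr.1 hr.1
  obtain ⟨X, Y, hXY⟩ := exists_lie_ne_zero_unitQuaternions
  exact ⟨3, UnitQuaternions, _, _, _, inferInstance, inferInstance, roundMetric, roundMetric, gt,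
    hr, hr, hgt, fun h => hXY (hgt.lie_eq_zero_of_isRightInvariant hr.1 h.2 X Y)⟩

end

end

theorem corollary2p7 :
    (∀ (E : Type*) [NormedAddCommGroup E] [NormedSpace ℝ E] [FiniteDimensional ℝ E]
      (G : Type*) [TopologicalSpace G] [ChartedSpace E G] [Group G] [LieGroup 𝓘(ℝ, E) ∞ G]
      (g₁ g₂ : SmoothMetric 𝓘(ℝ, E) G),
      g₁.IsBiInvariant → g₂.IsBiInvariant →
      (∃! gt : SmoothMetric 𝓘(ℝ, E).tangent (TangentBundle 𝓘(ℝ, E) G), IsLiftedMetric g₁ g₂ gt) ∧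
      ∀ gt : SmoothMetric 𝓘(ℝ, E).tangent (TangentBundle 𝓘(ℝ, E) G), IsLiftedMetric g₁ g₂ gt →
      ∀ cov : CovariantDerivative 𝓘(ℝ, E).tangent (E × E)
        (TangentSpace 𝓘(ℝ, E).tangent : TangentBundle 𝓘(ℝ, E) G → Type _),
      IsLeviCivita gt cov →
      ∀ (X Y : GroupLieAlgebra 𝓘(ℝ, E) G) (p : TangentBundle 𝓘(ℝ, E) G),
        cov (liftV Y) p (liftV X p) = 0 ∧
        cov (liftC Y) p (liftC X p) = (1 / 2 : ℝ) • liftC ⁅X, Y⁆ p ∧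
        cov (liftC Y) p (liftV X p) = 0 ∧
        cov (liftV Y) p (liftC X p) = liftV ⁅X, Y⁆ p) ∧
    (∃ (n : ℕ) (G : Type) (_ : TopologicalSpace G) (_ : ChartedSpace (EuclideanSpace ℝ (Fin n)) G)
      (_ : Group G) (_ : LieGroup (𝓡 n) ∞ G) (_ : ConnectedSpace G)
      (g₁ g₂ : SmoothMetric (𝓡 n) G)
      (gt : SmoothMetric (𝓡 n).tangent (TangentBundle (𝓡 n) G)),
      g₁.IsBiInvariant ∧ g₂.IsBiInvariant ∧ IsLiftedMetric g₁ g₂ gt ∧ ¬ gt.IsBiInvariant) := by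
  refine ⟨fun E _ _ _ G _ _ _ _ g₁ g₂ h₁ h₂ => ⟨?_, fun gt h cov hcov X Y p =>
    h.cov_formulas h₁ h₂ hcov X Y p⟩, exists_isLiftedMetric_not_isBiInvariant⟩
  obtain ⟨gt, h⟩ := exists_isLiftedMetric h₁.1 h₂.1
  exact ⟨gt, h, fun gt' h' => h'.unique h⟩
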